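/- **Setting.** Let $c\ge 1$ be an integer, and let $b_j\ge 0$ $(j\ne 1)$ and $h_j\ge 0$ $(j\ge 1)$ satisfy $0<-b_1=\sum_{j\neq 1}b_j<\infty$, $b_0>0$, $\sum_{j\ge 2}b_j>0$ and $0<h:=\sum_{j\ge1}h_j<\infty$. On $\{0,1,2,\dots\}$ let $Q^*=(q^*_{ij})$ be the conservative $q$-matrix with $q^*_{i,i-1}=\min(i,c)b_0$, $q^*_{ii}=b_1-(\min(i,c)-1)b_0$, $q^*_{ij}=b_{j-i+1}$ $(j\ge i+1)$ for $i\ge1$ and all other entries $0$; let $Q_s$ have entries $q^{(s)}_{00}=-h$, $q^{(s)}_{0j}=h_j$ $(j\ge1)$ and all other entries $0$; and put $\tilde Q=Q^*+Q_s$. For $\beta>0$ let the queue with $q$-matrix $\tilde Q$ be subject in addition to catastrophes, which in every state $i\ge1$ occur at rate $\beta$ (these are the effective ones, since they find the system non-empty), and let $C_{j0}$ be the time of the first effective catastrophe when the queue starts in state $j$. That is, $C_{j0}$ is the hitting time of $-1$, from the initial state $j$, of the Markov chain with right-continuous paths on $\{-1,0,1,\dots\}$ whose rates are those of $\tilde Q$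 on $\{0,1,2,\dots\}$ together with jumps at rate $\beta$ from each $i\ge1$ to the absorbing state $-1$. Put $B_c(s)=\sum_{j\ge0}b_js^j+(c-1)b_0(1-s)$, $B_c'(1)=\sum_{j\ge1}jb_j-(c-1)b_0\in(-\infty,\infty]$, $H(s)=\sum_{j\ge1}h_js^j$ and $\mu_1=\sum_{j\ge1}jh_j\in[0,\infty]$; let $u$ be the smallest root of $B_c(s)=0$ in $[0,1]$. With $(p^*_{ij}(t))$ the transition function of $Q^*$, put $m^*_i(k)=\int_0^\infty p^*_{ki}(t)\,dt$ and $r_k=\sum_{i\ge1}h_i\,m^*_k(i)$ for $i,k\ge 1$. **Theorem.** All the quantities $E(C_{j0})$ $(\beta>0,\ j\ge0)$, $m_k^*(i)$ and $r_k$ $(k,i\ge1)$ are finite, and the following hold. (i) If $B_c'(1)<0$ and $\mu_1<\infty$, then for every $j\ge0$ $$\lim_{\beta\downarrow0}\beta E(C_{j0})=\frac{-B_c'(1)+\mu_1+\sum_{k=1}^{c-1}r_k(c-k)b_0}{\mu_1+\sum_{k=1}^{c-1}r_k(c-k)b_0}=\frac1{1-\tilde\pi_0},$$ where $\tilde\pi$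 is an equilibrium distribution of $\tilde Q$ (a probability distribution with $\tilde\pi\tilde Q=0$); such a $\tilde\pi$ exists, and $\tilde\pi_0<1$ for each such $\tilde\pi$. (ii) If $B_c'(1)>0$, then, with $D:=h-H(u)+\sum_{k=1}^{c-1}u^{k-1}(c-k)b_0(1-u)r_k$, $$\lim_{\beta\downarrow0}\Big\{E(C_{00})-\frac1\beta\Big\}=\frac1D,\qquad \lim_{\beta\downarrow0}\Big\{E(C_{j0})-\frac1\beta\Big\}=\frac{b_0m_1^*(j)}{D}\quad(j\ge1).$$ (iii) Without any condition on $B_c'(1)$ or $\mu_1$, $$\lim_{\beta\to\infty}E(C_{00})=\frac1h,\qquad \lim_{\beta\to\infty}\beta E(C_{10})=1+\frac{b_0}{h},\qquad \lim_{\beta\to\infty}\beta E(C_{j0})=1\quad(j\ge2).$$ -/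

import Mathlib

open MeasureTheory Filter Topology
open scoped ENNReal NNReal

noncomputable section

namespace MXMc

/-! ### Markov jump processes with a given q-matrix on a countable state space -/

/-- Probability that the chain with q-matrix `Q` started at `i` is at `j` at time `t ≥ 0` after at
most `n` jumps, by decomposing according to the first jump:
`F₀(t) i j = δ_ij e^{q_ii t}` and
`F_{n+1}(t) i j = δ_ij e^{q_ii t} + ∫₀ᵗ e^{q_ii s} ∑_{k ≠ i} q_ik F_n(t - s) k j ds`. -/
def fellerIter {S : Type*} [DecidableEq S] (Q : S → S → ℝ) : ℕ → ℝ → S → S → ℝ≥0∞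
  | 0 => fun t i j => if i = j then ENNReal.ofReal (Real.exp (Q i i * t)) else 0
  | n + 1 => fun t i j =>
      (if i = j then ENNReal.ofReal (Real.exp (Q i i * t)) else 0) +
        ∫⁻ s in Set.Icc 0 t, ENNReal.ofReal (Real.exp (Q i i * s)) *
          ∑' k, (if k = i then 0 else ENNReal.ofReal (Q i k) * fellerIter Q n (t - s) k j)

/-- The Feller minimal transition function `p_ij(t)` of the q-matrix `Q`, i.e. the `Q`-function
(all q-matrices used below are bounded, so that the `Q`-function is unique). -/
def transFun {S : Type*} [DecidableEq S] (Q : S → S → ℝ) (t : ℝ) (i j : S) : ℝ≥0∞ :=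
  ⨆ n, fellerIter Q n t i j

/-- `M` is, under the probability measure `P`, the `Q`-process started at `i₀`: a process with
right-continuous (for the discrete topology) paths whose finite-dimensional distributions are those
of the Markov chain with transition function `transFun Q` and initial state `i₀`. -/
structure IsQProcess {S Ω : Type*} [DecidableEq S] [MeasurableSpace Ω] (Q : S → S → ℝ) (i₀ : S)
    (P : Measure Ω) (M : ℝ≥0 → Ω → S) : Prop where
  isProbabilityMeasure : IsProbabilityMeasure P
  measurableSet_eq : ∀ t x, MeasurableSet {ω | M t ω = x}
  rightContinuous : ∀ ω t, ∀ᶠ s in 𝓝[≥] t, M s ω = M t ω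
  finDimDistr : ∀ (n : ℕ) (t : ℕ → ℝ≥0) (x : ℕ → S), Monotone t → t 0 = 0 → x 0 = i₀ →
    P {ω | ∀ k ≤ n, M (t k) ω = x k} =
      ∏ k ∈ Finset.range n, transFun Q ((t (k + 1) : ℝ) - (t k : ℝ)) (x k) (x (k + 1))

/-- The first time at which the process `M` is in the state `x` (`∞` if there is none). -/
def hittingTime {S Ω : Type*} (M : ℝ≥0 → Ω → S) (x : S) (ω : Ω) : ℝ≥0∞ :=
  ⨅ t ∈ {t : ℝ≥0 | M t ω = x}, (t : ℝ≥0∞)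

/-- `π` is an equilibrium distribution for the (bounded, conservative) q-matrix `Q`: a probability
distribution with `π Q = 0`. -/
structure IsEquilibrium {S : Type*} (Q : S → S → ℝ) (π : S → ℝ) : Prop where
  nonneg : ∀ i, 0 ≤ π i
  hasSum_one : HasSum π 1
  balance : ∀ j, HasSum (fun i => π i * Q i j) 0

/-! ### The queueing model -/

/-- The parameters of the model: `c` servers, batch rates `b`, and resurrection rates `h`
(`h_j` only matters for `j ≥ 1`; by convention `h 0 = 0`), with `0 < ∑_{j ≥ 1} h_j < ∞` and
`0 < -b₁ = ∑_{j ≠ 1} b_j < ∞`. -/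
structure IsModel (c : ℕ) (b h : ℕ → ℝ) : Prop where
  one_le_c : 1 ≤ c
  b_nonneg : ∀ j, j ≠ 1 → 0 ≤ b j
  b_conservative : HasSum (fun j => if j = 1 then 0 else b j) (-b 1)
  b_zero_pos : 0 < b 0
  b_tail_pos : 0 < ∑' j, b (j + 2)
  h_zero : h 0 = 0
  h_nonneg : ∀ j, 0 ≤ h j
  h_summable : Summable h
  h_pos : 0 < ∑' j, h j

/-- The q-matrix `Q*` of the `M^X/M/c` queue stopped when it becomes empty. -/
def Qstar (c : ℕ) (b : ℕ → ℝ) (i j : ℕ) : ℝ :=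
  if i = 0 then 0
  else if j + 1 = i then ((min i c : ℕ) : ℝ) * b 0
  else if j = i then b 1 - (((min i c : ℕ) : ℝ) - 1) * b 0
  else if i + 1 ≤ j then b (j - i + 1)
  else 0

/-- The q-matrix `Q_s` of the arrivals at the empty system. -/
def Qs (h : ℕ → ℝ) (i j : ℕ) : ℝ :=
  if i = 0 then (if j = 0 then -∑' k, h k else h j) else 0

/-- The q-matrix `Q* + Q_s` of the queue with resurrection and without catastrophes. -/
def Qtilde (c : ℕ) (b h : ℕ → ℝ) (i j : ℕ) : ℝ :=
  Qstar c b i j + Qs h i j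

/-- Extension by zero of a matrix over `ℕ` to the state space `{-1, 0, 1, …}`, which is modelled
by `Option ℕ` with `none` in the role of `-1`. -/
def extendZero (Q : ℕ → ℕ → ℝ) : Option ℕ → Option ℕ → ℝ
  | some i, some j => Q i j
  | _, _ => 0

/-- Catastrophes at rate `β` in the states `i ≥ 1`, each leading to the state `-1`. -/
def QdBar (β : ℝ) : Option ℕ → Option ℕ → ℝ
  | some i, none => if 1 ≤ i then β else 0
  | some i, some j => if 1 ≤ i ∧ j = i then -β else 0
  | none, _ => 0

/-- The q-matrix on `{-1, 0, 1, …}` of the queue with resurrection in which an effective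
catastrophe, i.e. one that finds the system non-empty, leads to the absorbing state `-1`. -/
def QM (c : ℕ) (b h : ℕ → ℝ) (β : ℝ) (x y : Option ℕ) : ℝ :=
  extendZero (Qstar c b) x y + extendZero (Qs h) x y + QdBar β x y

/-! ### The quantities in the limits -/

/-- `B(s) = ∑ b_j s^j`. -/
def B (b : ℕ → ℝ) (s : ℝ) : ℝ := ∑' j, b j * s ^ j

/-- `B_i(s) = B(s) + (i - 1) b₀ (1 - s)`. -/
def Bi (b : ℕ → ℝ) (i : ℕ) (s : ℝ) : ℝ := B b s + ((i : ℝ) - 1) * b 0 * (1 - s)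

/-- `B_i'(1) = ∑_{j ≥ 1} j b_j - (i - 1) b₀ ∈ (-∞, +∞]`; the terms with `j ≥ 2` are nonnegative
and their sum may be infinite. -/
def BiDerivOne (b : ℕ → ℝ) (i : ℕ) : EReal :=
  ((b 1 - ((i : ℝ) - 1) * b 0 : ℝ) : EReal) +
    ((∑' j : ℕ, ENNReal.ofReal (((j + 2 : ℕ) : ℝ) * b (j + 2)) : ℝ≥0∞) : EReal)

/-- The smallest root `u` of `B_c(s) = 0` in `[0, 1]` (`s = 1` is a root and `B_c` is continuous on
`[0, 1]`, so the infimum is attained). -/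
def smallestRoot (c : ℕ) (b : ℕ → ℝ) : ℝ := sInf {s | 0 ≤ s ∧ s ≤ 1 ∧ Bi b c s = 0}

/-- `H(s) = ∑ h_j s^j`. -/
def H (h : ℕ → ℝ) (s : ℝ) : ℝ := ∑' j, h j * s ^ j

/-- `μ₁ = H'(1) = ∑ j h_j ∈ [0, ∞]`. -/
def mu1 (h : ℕ → ℝ) : ℝ≥0∞ := ∑' j : ℕ, ENNReal.ofReal ((j : ℝ) * h j)

/-- `m*_i(k) = ∫₀^∞ p*_ki(t) dt`. -/
def mstar (c : ℕ) (b : ℕ → ℝ) (i k : ℕ) : ℝ≥0∞ :=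
  ∫⁻ t in Set.Ici (0 : ℝ), transFun (Qstar c b) t k i

/-- `r_k = ∑_{i ≥ 1} h_i m*_k(i)`. -/
def r (c : ℕ) (b h : ℕ → ℝ) (k : ℕ) : ℝ≥0∞ :=
  ∑' i : ℕ, ENNReal.ofReal (h i) * mstar c b k i

/-- `∑_{k=1}^{c-1} r_k (c - k) b₀`. -/
def rSum (c : ℕ) (b h : ℕ → ℝ) : ℝ :=
  ∑ k ∈ Finset.Ico 1 c, (r c b h k).toReal * ((c : ℝ) - k) * b 0

/-- `h - H(u) + ∑_{k=1}^{c-1} u^{k-1} (c - k) b₀ (1 - u) r_k`, with `u` the smallest root. -/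
def transientDenom (c : ℕ) (b h : ℕ → ℝ) : ℝ :=
  (∑' j, h j) - H h (smallestRoot c b) +
    ∑ k ∈ Finset.Ico 1 c, smallestRoot c b ^ (k - 1) * ((c : ℝ) - k) * b 0 *
      (1 - smallestRoot c b) * (r c b h k).toReal

end MXMc

end

/-! Every expectation and Green function involved is the minimal nonnegative solution of a
first-step system `d i * x i = γ i + ∑ l, a i l * x l` in `ℝ≥0∞`, given by a Neumann series
(`minSol`). Three facts do most of the work: supersolutions dominate the minimal solution
(`minSol_le`); a subsolution lies below it once a multiple of some finite minimal solution dominates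
that subsolution (`le_minSol`); and as the killing rate decreases to 0 the minimal solution
increases to its unkilled value (`tendsto_minSol`). The probability enters only through
`lintegral_transFun` and `IsQProcess.lintegral_hittingTime_eq_minSol`.

Cut the path at its visits to 0. For the queue stopped at 0 and killed at rate β while busy, let f_j
be the probability of emptying before being killed and t_j the mean time until one of the two
happens, so that f_j + β t_j = 1. Put F = ∑ h_l f_l and T = ∑ h_l t_l, so that F + β T = h. From E_j
= t_j + f_j E_0 and h E_0 = 1 + T + F E_0 one gets β E_j = 1 + f_j / T and E_j - 1/β = f_j / (h - F)
(`IsCatastropheTime.mul_toReal`, `IsCatastropheTime.toReal_sub`). The limits β ↓ 0 thus need only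
f_j, T and F at β = 0.

Negative B_c'(1): the function i ↦ i solves the system with source -B_c'(1) up to the idle capacity
(c - k) b₀ in the states k < c. Hence -B_c'(1) t_i(0) equals i plus a finite combination of Green
functions (`IsModel.mul_busyTime_eq`); so t_i(0) is finite, f_i(0) = 1, and T(0) is explicit.
Testing an equilibrium π against f gives π_0 T(0) = 1 - π_0, and the h-average of the Green
functions, with weight 1 at 0, normalises to an equilibrium.

Positive B_c'(1): since B_c(u) = 0, the function i ↦ u^i solves the system with a source supported
on {0, …, c-1}, and it is the minimal solution because B_c is negative somewhere in (u, 1)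
(`IsModel.smallestRoot_pow_eq`). Averaging over h identifies h - F(0) with D, and f_j(0) = b₀
m*_1(j) because 0 is entered only from 1.

For β → ∞ an explicit supersolution of order 1/β on the states i ≥ 1 squeezes the first-step
equations. -/

namespace MXMc

/-! ### Minimal nonnegative solutions of countable linear systems -/

section MinSol

variable {S : Type*}

/-- One step of the iteration for the system `d i * x i = γ i + ∑ l, a i l * x l`. -/
noncomputable def step (d : S → ℝ≥0∞) (a : S → S → ℝ≥0∞) (x : S → ℝ≥0∞) (i : S) : ℝ≥0∞ :=
  (∑' l, a i l * x l) / d i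

/-- The terms of the Neumann series of the system `d i * x i = γ i + ∑ l, a i l * x l`. -/
noncomputable def neumannTerm (d : S → ℝ≥0∞) (a : S → S → ℝ≥0∞) (γ : S → ℝ≥0∞) :
    ℕ → S → ℝ≥0∞
  | 0 => fun i => γ i / d i
  | n + 1 => step d a (neumannTerm d a γ n)

/-- The minimal nonnegative solution of the system `d i * x i = γ i + ∑ l, a i l * x l`. -/
noncomputable def minSol (d : S → ℝ≥0∞) (a : S → S → ℝ≥0∞) (γ : S → ℝ≥0∞) (i : S) : ℝ≥0∞ :=
  ∑' n, neumannTerm d a γ n i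

variable {d : S → ℝ≥0∞} {a : S → S → ℝ≥0∞} {γ γ' x : S → ℝ≥0∞}

lemma step_tsum {ι : Type*} (f : ι → S → ℝ≥0∞) (i : S) :
    step d a (fun l => ∑' k, f k l) i = ∑' k, step d a (f k) i := by
  simp only [step, div_eq_mul_inv, ENNReal.tsum_mul_right, ← ENNReal.tsum_mul_left]
  rw [ENNReal.tsum_comm]

lemma step_const_mul (C : ℝ≥0∞) (i : S) :
    step d a (fun l => C * x l) i = C * step d a x i := by
  simp only [step, div_eq_mul_inv]
  rw [← mul_assoc, ← ENNReal.tsum_mul_left]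
  congr 2; ext l; ring

lemma step_add (y : S → ℝ≥0∞) (i : S) :
    step d a (fun l => x l + y l) i = step d a x i + step d a y i := by
  simp only [step, mul_add, ENNReal.tsum_add, ENNReal.add_div]

lemma step_mono {y : S → ℝ≥0∞} (h : ∀ i, x i ≤ y i) (i : S) : step d a x i ≤ step d a y i := by
  unfold step
  gcongr with l
  exact h l

lemma neumannTerm_tsum {ι : Type*} (f : ι → S → ℝ≥0∞) (n : ℕ) (i : S) :
    neumannTerm d a (fun l => ∑' k, f k l) n i = ∑' k, neumannTerm d a (f k) n i := by
  induction n generalizing i with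
  | zero => simp only [neumannTerm, div_eq_mul_inv, ENNReal.tsum_mul_right]
  | succ n ih =>
    simp only [neumannTerm]
    rw [← step_tsum]
    congr 1; ext l; exact ih l

lemma neumannTerm_const_mul (C : ℝ≥0∞) (n : ℕ) (i : S) :
    neumannTerm d a (fun l => C * γ l) n i = C * neumannTerm d a γ n i := by
  induction n generalizing i with
  | zero => simp only [neumannTerm, mul_div_assoc]
  | succ n ih =>
    simp only [neumannTerm]
    rw [← step_const_mul]
    congr 1; ext l; exact ih l

lemma minSol_tsum {ι : Type*} (f : ι → S → ℝ≥0∞) (i : S) :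
    minSol d a (fun l => ∑' k, f k l) i = ∑' k, minSol d a (f k) i := by
  simp only [minSol, neumannTerm_tsum]
  rw [ENNReal.tsum_comm]

lemma minSol_const_mul (C : ℝ≥0∞) (i : S) :
    minSol d a (fun l => C * γ l) i = C * minSol d a γ i := by
  simp only [minSol, neumannTerm_const_mul, ENNReal.tsum_mul_left]

lemma minSol_add (i : S) :
    minSol d a (fun l => γ l + γ' l) i = minSol d a γ i + minSol d a γ' i := by
  have := minSol_tsum (d := d) (a := a) (fun b : Bool => fun l => cond b (γ l) (γ' l)) i
  simpa [tsum_bool, add_comm] using this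

/-- Decomposition of a minimal solution over point sources. -/
lemma minSol_eq_tsum_single [DecidableEq S] (i : S) :
    minSol d a γ i = ∑' k, γ k * minSol d a (Pi.single k 1) i := by
  simp only [← minSol_const_mul]
  rw [← minSol_tsum]
  congr 1; ext l
  rw [tsum_eq_single l]
  · simp
  · intro k hk
    simp [hk.symm]

lemma minSol_eq_step (i : S) : minSol d a γ i = γ i / d i + step d a (minSol d a γ) i := by
  have : step d a (minSol d a γ) i = ∑' n, neumannTerm d a γ (n + 1) i := by
    unfold minSol
    rw [step_tsum]; rfl
  rw [this, minSol, tsum_eq_zero_add' ENNReal.summable]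
  rfl

/-- The recursion applies the matrix on the outside; by associativity one factor may be absorbed
into the source instead. This is what converts first-step equations into forward equations. -/
lemma neumannTerm_shift (n : ℕ) (i : S) :
    neumannTerm d a γ (n + 1) i = neumannTerm d a (fun i => ∑' l, a i l * (γ l / d l)) n i := by
  induction n generalizing i with
  | zero => rfl
  | succ n ih =>
    rw [neumannTerm, neumannTerm]
    congr 1; ext l; exact ih l

/-- The forward form of the equation for a minimal solution. -/
lemma minSol_eq_add_minSol (i : S) :
    minSol d a γ i = γ i / d i + minSol d a (fun i => ∑' l, a i l * (γ l / d l)) i := by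
  rw [minSol, tsum_eq_zero_add' ENNReal.summable]
  simp only [neumannTerm_shift]
  rfl

lemma mul_minSol (hd0 : ∀ i, d i ≠ 0) (hd : ∀ i, d i ≠ ∞) (i : S) :
    d i * minSol d a γ i = γ i + ∑' l, a i l * minSol d a γ l := by
  rw [minSol_eq_step, mul_add, step, ENNReal.mul_div_cancel (hd0 i) (hd i),
    ENNReal.mul_div_cancel (hd0 i) (hd i)]

lemma sum_neumannTerm_succ (n : ℕ) (i : S) :
    ∑ m ∈ Finset.range (n + 1), neumannTerm d a γ m i =
      γ i / d i + step d a (fun l => ∑ m ∈ Finset.range n, neumannTerm d a γ m l) i := by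
  rw [Finset.sum_range_succ', add_comm]
  congr 1
  induction n with
  | zero => simp [step]
  | succ n ih =>
    rw [Finset.sum_range_succ, ih]
    simp only [Finset.sum_range_succ]
    rw [step_add]
    rfl

/-- Supersolutions dominate the minimal solution. -/
lemma minSol_le (hd0 : ∀ i, d i ≠ 0) (hd : ∀ i, d i ≠ ∞)
    (h : ∀ i, γ i + ∑' l, a i l * x l ≤ d i * x i) (i : S) : minSol d a γ i ≤ x i := by
  rw [minSol, ENNReal.tsum_eq_iSup_nat]
  refine iSup_le fun n => ?_
  induction n generalizing i with
  | zero => simp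
  | succ n ih =>
    rw [sum_neumannTerm_succ]
    calc γ i / d i + step d a (fun l => ∑ m ∈ Finset.range n, neumannTerm d a γ m l) i
        ≤ γ i / d i + step d a x i := by gcongr; exact step_mono ih i
      _ = (γ i + ∑' l, a i l * x l) / d i := by rw [step, ENNReal.add_div]
      _ ≤ (d i * x i) / d i := by gcongr; exact h i
      _ = x i := by rw [mul_comm, ENNReal.mul_div_cancel_right (hd0 i) (hd i)]

/-- Iterating the step on a minimal solution produces a tail of its series, which controls the
remainder in `le_minSol`. -/
lemma iterate_step_neumannTerm (n m : ℕ) (i : S) :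
    (step d a)^[n] (neumannTerm d a γ m) i = neumannTerm d a γ (m + n) i := by
  induction n generalizing m with
  | zero => rfl
  | succ n ih =>
    rw [Function.iterate_succ_apply]
    rw [show m + (n + 1) = (m + 1) + n by ring, ← ih]
    rfl

lemma iterate_step_tsum {ι : Type*} (f : ι → S → ℝ≥0∞) (n : ℕ) :
    (step d a)^[n] (fun l => ∑' k, f k l) = fun i => ∑' k, (step d a)^[n] (f k) i := by
  induction n with
  | zero => rfl
  | succ n ih =>
    simp only [Function.iterate_succ_apply', ih]
    ext i; rw [step_tsum]

lemma iterate_step_const_mul (C : ℝ≥0∞) (n : ℕ) :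
    (step d a)^[n] (fun l => C * x l) = fun i => C * (step d a)^[n] x i := by
  induction n with
  | zero => rfl
  | succ n ih =>
    simp only [Function.iterate_succ_apply', ih]
    ext i; rw [step_const_mul]

lemma iterate_step_mono {y : S → ℝ≥0∞} (h : ∀ i, x i ≤ y i) (n : ℕ) (i : S) :
    (step d a)^[n] x i ≤ (step d a)^[n] y i := by
  induction n generalizing i with
  | zero => exact h i
  | succ n ih =>
    simp only [Function.iterate_succ_apply']
    exact step_mono ih i

/-- A subsolution which is dominated by a multiple of a finite minimal solution (possibly for
another source) is dominated by the minimal solution. -/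
lemma le_minSol (hd0 : ∀ i, d i ≠ 0) (hd : ∀ i, d i ≠ ∞)
    (h : ∀ i, d i * x i ≤ γ i + ∑' l, a i l * x l) {C : ℝ≥0∞} (hC : C ≠ ∞)
    (hx : ∀ i, x i ≤ C * minSol d a γ' i) (i : S) (hfin : minSol d a γ' i ≠ ∞) :
    x i ≤ minSol d a γ i := by
  have h1 : ∀ i, x i ≤ γ i / d i + step d a x i := by
    intro i
    rw [step, ← ENNReal.add_div, ENNReal.le_div_iff_mul_le (Or.inl (hd0 i)) (Or.inl (hd i)),
      mul_comm]
    exact h i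
  -- Unfold the subsolution inequality `n` times; what remains is to make the remainder vanish.
  have h2 : ∀ n i, x i ≤ ∑ m ∈ Finset.range n, neumannTerm d a γ m i + (step d a)^[n] x i := by
    intro n
    induction n with
    | zero => intro i; simp
    | succ n ih =>
      intro i
      rw [sum_neumannTerm_succ, add_assoc, Function.iterate_succ_apply', ← step_add]
      refine (h1 i).trans ?_
      gcongr
      exact step_mono ih i
  -- Domination bounds the remainder by a tail of a series that converges at `i`.
  have h3 : ∀ n, (step d a)^[n] x i ≤ C * ∑' m, neumannTerm d a γ' (m + n) i := by
    intro n
    refine (iterate_step_mono hx n i).trans ?_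
    rw [iterate_step_const_mul]
    unfold minSol
    rw [iterate_step_tsum]
    simp only [iterate_step_neumannTerm, le_refl]
  have h4 : Tendsto (fun n => minSol d a γ i + C * ∑' m, neumannTerm d a γ' (m + n) i) atTop
      (𝓝 (minSol d a γ i + C * 0)) := by
    refine Tendsto.const_add _ (ENNReal.Tendsto.const_mul ?_ (Or.inr hC))
    exact ENNReal.tendsto_sum_nat_add (fun m => neumannTerm d a γ' m i) hfin
  rw [mul_zero, add_zero] at h4
  refine ge_of_tendsto' h4 fun n => (h2 n i).trans ?_
  gcongr
  · exact ENNReal.sum_le_tsum _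
  · exact h3 n

lemma minSol_mono (h : ∀ i, γ i ≤ γ' i) (hd0 : ∀ i, d i ≠ 0) (hd : ∀ i, d i ≠ ∞) (i : S) :
    minSol d a γ i ≤ minSol d a γ' i :=
  minSol_le hd0 hd (fun i => by rw [mul_minSol hd0 hd]; gcongr; exact h i) i

end MinSol

/-! ### Killing at a vanishing rate -/

section Limit

variable {S : Type*} {d e : S → ℝ≥0∞} {a : S → S → ℝ≥0∞} {γ : S → ℝ≥0∞}

/-- The solution for a smaller killing rate is a supersolution for a larger one. -/
lemma minSol_antitone (hd0 : ∀ i, d i ≠ 0) (hd : ∀ i, d i ≠ ∞) (he : ∀ i, e i ≠ ∞) (i : S) :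
    Antitone fun β : ℝ => minSol (fun i => d i + ENNReal.ofReal β * e i) a γ i := by
  have hf : ∀ (β : ℝ) i, d i + ENNReal.ofReal β * e i ≠ ∞ := fun β i =>
    ENNReal.add_ne_top.2 ⟨hd i, ENNReal.mul_ne_top ENNReal.ofReal_ne_top (he i)⟩
  intro β β' hβ
  refine minSol_le (fun i => by simp [hd0]) (hf β') (fun i => ?_) i
  rw [← mul_minSol (d := fun i => d i + ENNReal.ofReal β * e i) (fun i => by simp [hd0]) (hf β)]
  gcongr

/-- Minimal solutions depend continuously on the killing rate `β ↓ 0`. -/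
lemma tendsto_minSol (hd0 : ∀ i, d i ≠ 0) (hd : ∀ i, d i ≠ ∞) (he : ∀ i, e i ≠ ∞)
    (ha : ∀ i l, a i l ≠ ∞) (i : S) :
    Tendsto (fun β : ℝ => minSol (fun i => d i + ENNReal.ofReal β * e i) a γ i) (𝓝[>] 0)
      (𝓝 (minSol d a γ i)) := by
  have hf : ∀ (β : ℝ) i, d i + ENNReal.ofReal β * e i ≠ ∞ := fun β i =>
    ENNReal.add_ne_top.2 ⟨hd i, ENNReal.mul_ne_top ENNReal.ofReal_ne_top (he i)⟩
  have hlim := fun i => (minSol_antitone (a := a) (γ := γ) hd0 hd he i).tendsto_nhdsGT 0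
  set L : S → ℝ≥0∞ := fun i =>
    sSup ((fun β : ℝ => minSol (fun i => d i + ENNReal.ofReal β * e i) a γ i) '' Set.Ioi 0)
    with hL
  have hle : L i ≤ minSol d a γ i := by
    refine sSup_le ?_
    rintro _ ⟨β, hβ, rfl⟩
    have := minSol_antitone (a := a) (γ := γ) hd0 hd he i (le_of_lt hβ)
    simpa using this
  have hge : minSol d a γ i ≤ L i := by
    -- The monotone limit `L` is a supersolution of the unkilled system: over finitely many states
    -- the inequality passes to the limit, and the supremum over finite sets restores the full sum.
    refine minSol_le hd0 hd (fun i => ?_) i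
    rw [ENNReal.tsum_eq_iSup_sum, ENNReal.add_iSup]
    refine iSup_le fun F => ?_
    have h1 : Tendsto (fun β : ℝ => γ i + ∑ l ∈ F, a i l *
        minSol (fun i => d i + ENNReal.ofReal β * e i) a γ l) (𝓝[>] 0)
        (𝓝 (γ i + ∑ l ∈ F, a i l * L l)) :=
      (tendsto_finsetSum _ fun l _ =>
        ENNReal.Tendsto.const_mul (hlim l) (Or.inr (ha i l))).const_add _
    have h2 : Tendsto (fun β : ℝ => (d i + ENNReal.ofReal β * e i) *
        minSol (fun i => d i + ENNReal.ofReal β * e i) a γ i) (𝓝[>] 0) (𝓝 (d i * L i)) := by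
      refine ENNReal.Tendsto.mul ?_ (Or.inl (hd0 i)) (hlim i) (Or.inr (hd i))
      have : Tendsto (fun β : ℝ => d i + ENNReal.ofReal β * e i) (𝓝[>] 0)
          (𝓝 (d i + ENNReal.ofReal 0 * e i)) := by
        refine Tendsto.const_add _ (ENNReal.Tendsto.mul_const ?_ (Or.inr (he i)))
        exact (ENNReal.continuous_ofReal.tendsto 0).mono_left nhdsWithin_le_nhds
      simpa using this
    refine le_of_tendsto_of_tendsto' h1 h2 fun β => ?_
    rw [mul_minSol (d := fun i => d i + ENNReal.ofReal β * e i) (fun i => by simp [hd0]) (hf β)]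
    gcongr
    exact ENNReal.sum_le_tsum _
  rw [le_antisymm hge hle]
  exact hlim i

/-- Monotone convergence by hand: finite partial sums give the lower bound, antitonicity in the
killing rate the upper one. The limit may be infinite. -/
lemma tendsto_tsum_minSol (hd0 : ∀ i, d i ≠ 0) (hd : ∀ i, d i ≠ ∞) (he : ∀ i, e i ≠ ∞)
    (ha : ∀ i l, a i l ≠ ∞) {w : S → ℝ≥0∞} (hw : ∀ i, w i ≠ ∞) :
    Tendsto (fun β : ℝ => ∑' i, w i * minSol (fun i => d i + ENNReal.ofReal β * e i) a γ i)
      (𝓝[>] 0) (𝓝 (∑' i, w i * minSol d a γ i)) := by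
  refine tendsto_order.2 ⟨fun r hr => ?_, fun r hr => ?_⟩
  · rw [ENNReal.tsum_eq_iSup_sum, lt_iSup_iff] at hr
    obtain ⟨F, hF⟩ := hr
    have h1 : Tendsto (fun β : ℝ => ∑ i ∈ F, w i *
        minSol (fun i => d i + ENNReal.ofReal β * e i) a γ i) (𝓝[>] 0)
        (𝓝 (∑ i ∈ F, w i * minSol d a γ i)) :=
      tendsto_finsetSum _ fun l _ =>
        ENNReal.Tendsto.const_mul (tendsto_minSol hd0 hd he ha l) (Or.inr (hw l))
    filter_upwards [h1.eventually (lt_mem_nhds hF)] with β hβ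
    exact hβ.trans_le (ENNReal.sum_le_tsum _)
  · filter_upwards [self_mem_nhdsWithin] with β hβ
    refine lt_of_le_of_lt ?_ hr
    gcongr with i
    have := minSol_antitone (a := a) (γ := γ) hd0 hd he i (le_of_lt hβ)
    simpa using this

end Limit

/-! ### Green functions of transition functions -/

section Green

lemma setLIntegral_Icc_eq_conv (A F : ℝ → ℝ≥0∞) (t : ℝ) :
    ∫⁻ s in Set.Icc 0 t, A s * F (t - s) =
      ∫⁻ s, (Set.Ici 0).indicator A s * (Set.Ici 0).indicator F (t - s) := by
  rw [← lintegral_indicator measurableSet_Icc]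
  congr 1; ext s
  by_cases h1 : 0 ≤ s <;> by_cases h2 : s ≤ t <;> simp [Set.indicator, h1, h2]

lemma measurable_conv {A F : ℝ → ℝ≥0∞} (hA : Measurable A) (hF : Measurable F) :
    Measurable fun t : ℝ => ∫⁻ s in Set.Icc 0 t, A s * F (t - s) := by
  simp only [setLIntegral_Icc_eq_conv]
  refine Measurable.lintegral_prod_right'
    (f := fun p : ℝ × ℝ => (Set.Ici 0).indicator A p.2 * (Set.Ici 0).indicator F (p.1 - p.2)) ?_
  exact ((hA.indicator measurableSet_Ici).comp measurable_snd).mul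
    ((hF.indicator measurableSet_Ici).comp (measurable_fst.sub measurable_snd))

/-- Tonelli and translation invariance, after both functions are extended by zero to the whole line.
Applied to the first-jump decomposition, this splits off the mean holding time as a factor. -/
lemma lintegral_conv {A F : ℝ → ℝ≥0∞} (hA : Measurable A) (hF : Measurable F) :
    ∫⁻ t in Set.Ici (0 : ℝ), ∫⁻ s in Set.Icc 0 t, A s * F (t - s) =
      (∫⁻ s in Set.Ici (0 : ℝ), A s) * ∫⁻ t in Set.Ici (0 : ℝ), F t := by
  have h1 : ∫⁻ t in Set.Ici (0 : ℝ), ∫⁻ s in Set.Icc 0 t, A s * F (t - s) =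
      ∫⁻ t, ∫⁻ s in Set.Icc 0 t, A s * F (t - s) := by
    rw [← lintegral_indicator measurableSet_Ici]
    congr 1; ext t
    by_cases ht : 0 ≤ t
    · simp [ht]
    · simp [ht]
  rw [h1]
  simp only [setLIntegral_Icc_eq_conv]
  rw [lintegral_lintegral_swap]
  · have h2 : ∀ s, ∫⁻ t, (Set.Ici 0).indicator A s * (Set.Ici 0).indicator F (t - s) =
        (Set.Ici 0).indicator A s * ∫⁻ t, (Set.Ici 0).indicator F t := by
      intro s
      have hm : Measurable fun t => (Set.Ici 0).indicator F (t - s) :=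
        (hF.indicator measurableSet_Ici).comp (measurable_id.sub measurable_const)
      rw [lintegral_const_mul _ hm, lintegral_sub_right_eq_self]
    simp only [h2]
    rw [lintegral_mul_const _ (hA.indicator measurableSet_Ici),
      lintegral_indicator measurableSet_Ici, lintegral_indicator measurableSet_Ici]
  · exact (((hA.indicator measurableSet_Ici).comp measurable_snd).mul
      ((hF.indicator measurableSet_Ici).comp (measurable_fst.sub measurable_snd))).aemeasurable

lemma lintegral_exp_mul {q : ℝ} (hq : q < 0) :
    ∫⁻ s in Set.Ici (0 : ℝ), ENNReal.ofReal (Real.exp (q * s)) = (ENNReal.ofReal (-q))⁻¹ := by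
  rw [← restrict_Ioi_eq_restrict_Ici, ← ofReal_integral_eq_lintegral_ofReal
    (integrableOn_exp_mul_Ioi hq 0) (ae_of_all _ fun _ => (Real.exp_pos _).le),
    integral_exp_mul_Ioi hq]
  rw [← ENNReal.ofReal_inv_of_pos (by linarith), mul_zero, Real.exp_zero, inv_neg, neg_div, one_div]

variable {S : Type*} [DecidableEq S] {Q : S → S → ℝ}

lemma transFun_eq_zero_of_absorbing {o : S} (ho : ∀ k, Q o k = 0) {j : S} (hj : j ≠ o) (t : ℝ) :
    transFun Q t o j = 0 := by
  rw [transFun, ENNReal.iSup_eq_zero]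
  intro n
  cases n with
  | zero => simp [fellerIter, hj.symm]
  | succ n => simp [fellerIter, hj.symm, ho]

lemma fellerIter_mono (t : ℝ) (i j : S) : Monotone fun n => fellerIter Q n t i j := by
  refine monotone_nat_of_le_succ fun n => ?_
  induction n generalizing t i with
  | zero => simp only [fellerIter]; exact le_self_add
  | succ n ih =>
    rw [fellerIter.eq_2 Q n, fellerIter.eq_2 Q (n + 1)]
    refine add_le_add_right (lintegral_mono fun s => mul_le_mul_right
      (ENNReal.tsum_le_tsum fun k => ?_) _) _
    split_ifs
    · exact le_rfl
    · exact mul_le_mul_right (ih _ _) _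

/-- Total exit rates of a q-matrix with absorbing state `o` (where the value is immaterial). -/
noncomputable def exitRate (Q : S → S → ℝ) (o i : S) : ℝ≥0∞ :=
  if i = o then 1 else ENNReal.ofReal (-Q i i)

/-- Off-diagonal part of a q-matrix. -/
noncomputable def offDiag (Q : S → S → ℝ) (i k : S) : ℝ≥0∞ :=
  if k = i then 0 else ENNReal.ofReal (Q i k)

variable [Countable S]

lemma measurable_fellerIter (n : ℕ) (i j : S) : Measurable fun t => fellerIter Q n t i j := by
  induction n generalizing i with
  | zero =>
    simp only [fellerIter]
    split_ifs <;> fun_prop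
  | succ n ih =>
    simp only [fellerIter]
    refine Measurable.add (by split_ifs <;> fun_prop) ?_
    refine measurable_conv (A := fun s => ENNReal.ofReal (Real.exp (Q i i * s)))
      (F := fun t => ∑' k, (if k = i then 0 else ENNReal.ofReal (Q i k) * fellerIter Q n t k j))
      (by fun_prop) ?_
    refine Measurable.tsum fun k => ?_
    split_ifs
    · fun_prop
    · exact (ih k).const_mul _

/-- Allowing at most `n` jumps corresponds to truncating the Neumann series: integrating over time
turns the convolution with the holding time into division by the exit rate. -/
lemma lintegral_fellerIter {o : S} (ho : ∀ k, Q o k = 0) (hQ : ∀ i, i ≠ o → Q i i < 0) {j : S}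
    (hj : j ≠ o) (n : ℕ) (i : S) :
    ∫⁻ t in Set.Ici (0 : ℝ), fellerIter Q n t i j =
      ∑ m ∈ Finset.range (n + 1), neumannTerm (exitRate Q o) (offDiag Q) (Pi.single j 1) m i := by
  have h0 : ∀ i, ∫⁻ t in Set.Ici (0 : ℝ),
      (if i = j then ENNReal.ofReal (Real.exp (Q i i * t)) else 0) =
      (Pi.single j 1 : S → ℝ≥0∞) i / exitRate Q o i := by
    intro i
    by_cases h : i = j
    · subst h
      simp only [if_true, Pi.single_eq_same]
      rw [lintegral_exp_mul (hQ i hj), exitRate, if_neg hj, one_div]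
    · simp [h]
  induction n generalizing i with
  | zero =>
    simp only [fellerIter, h0]
    simp [neumannTerm]
  | succ n ih =>
    rw [sum_neumannTerm_succ]
    simp only [fellerIter]
    rw [lintegral_add_left (by split_ifs <;> fun_prop), h0]
    congr 1
    have hm : ∀ k, Measurable fun t : ℝ =>
        (if k = i then 0 else ENNReal.ofReal (Q i k) * fellerIter Q n t k j) := by
      intro k
      split_ifs
      · fun_prop
      · exact (measurable_fellerIter n k j).const_mul _
    rw [lintegral_conv (A := fun s => ENNReal.ofReal (Real.exp (Q i i * s)))
      (F := fun t => ∑' k, (if k = i then 0 else ENNReal.ofReal (Q i k) * fellerIter Q n t k j))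
      (by fun_prop) (Measurable.tsum hm),
      lintegral_tsum fun k => (hm k).aemeasurable]
    have h2 : ∀ k, ∫⁻ t in Set.Ici (0 : ℝ),
        (if k = i then 0 else ENNReal.ofReal (Q i k) * fellerIter Q n t k j) =
        offDiag Q i k *
        ∑ m ∈ Finset.range (n + 1), neumannTerm (exitRate Q o) (offDiag Q) (Pi.single j 1) m k := by
      intro k
      unfold offDiag
      split_ifs
      · simp
      · rw [lintegral_const_mul _ (measurable_fellerIter n k j), ih]; rfl
    simp only [h2]
    rw [step, mul_comm, div_eq_mul_inv]
    -- At the absorbing state the holding-time integral is infinite, but no jump leaves it, so both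
    -- sides vanish and the conventional exit rate 1 plays no role.
    by_cases hi : i = o
    · subst hi
      have : ∀ k, offDiag Q i k = 0 := fun k => by simp [offDiag, ho]
      simp [this]
    · rw [lintegral_exp_mul (hQ i hi), exitRate, if_neg hi]

/-- The Green function of the transition function as a minimal solution. -/
lemma lintegral_transFun {o : S} (ho : ∀ k, Q o k = 0) (hQ : ∀ i, i ≠ o → Q i i < 0) {j : S}
    (hj : j ≠ o) (i : S) :
    ∫⁻ t in Set.Ici (0 : ℝ), transFun Q t i j =
      minSol (exitRate Q o) (offDiag Q) (Pi.single j 1) i := by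
  simp only [transFun]
  rw [lintegral_iSup (fun n => measurable_fellerIter n i j)
    (fun m n hmn t => fellerIter_mono t i j hmn)]
  simp only [lintegral_fellerIter ho hQ hj]
  rw [minSol, ENNReal.tsum_eq_iSup_nat' (tendsto_add_atTop_nat 1)]

lemma measurable_transFun (i j : S) : Measurable fun t => transFun Q t i j :=
  Measurable.iSup fun n => measurable_fellerIter n i j

end Green

/-! ### Expected hitting times of an absorbing state -/

section Hitting

lemma setLIntegral_indicator_lt (e : ℝ≥0∞) :
    ∫⁻ t in Set.Ici (0 : ℝ), {t : ℝ | ENNReal.ofReal t < e}.indicator 1 t = e := by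
  rw [lintegral_indicator_one (measurableSet_lt ENNReal.measurable_ofReal measurable_const),
    Measure.restrict_apply (measurableSet_lt ENNReal.measurable_ofReal measurable_const)]
  by_cases he : e = ∞
  · have : {t : ℝ | ENNReal.ofReal t < e} ∩ Set.Ici 0 = Set.Ici 0 := by
      ext t; simp [he]
    rw [this, Real.volume_Ici, he]
  · have : {t : ℝ | ENNReal.ofReal t < e} ∩ Set.Ici 0 = Set.Ico 0 e.toReal := by
      ext t
      simp only [Set.mem_inter_iff, Set.mem_ofPred_eq, Set.mem_Ici, Set.mem_Ico]
      constructor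
      · rintro ⟨h1, h2⟩
        exact ⟨h2, (ENNReal.ofReal_lt_iff_lt_toReal h2 he).1 h1⟩
      · rintro ⟨h1, h2⟩
        exact ⟨(ENNReal.ofReal_lt_iff_lt_toReal h1 he).2 h2, h1⟩
    rw [this, Real.volume_Ico, sub_zero, ENNReal.ofReal_toReal he]

lemma setLIntegral_indicator_le (e : ℝ≥0∞) :
    ∫⁻ t in Set.Ici (0 : ℝ), {t : ℝ | ENNReal.ofReal t ≤ e}.indicator 1 t = e := by
  rw [lintegral_indicator_one (measurableSet_le ENNReal.measurable_ofReal measurable_const),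
    Measure.restrict_apply (measurableSet_le ENNReal.measurable_ofReal measurable_const)]
  by_cases he : e = ∞
  · have : {t : ℝ | ENNReal.ofReal t ≤ e} ∩ Set.Ici 0 = Set.Ici 0 := by
      ext t; simp [he]
    rw [this, Real.volume_Ici, he]
  · have : {t : ℝ | ENNReal.ofReal t ≤ e} ∩ Set.Ici 0 = Set.Icc 0 e.toReal := by
      ext t
      simp only [Set.mem_inter_iff, Set.mem_ofPred_eq, Set.mem_Ici, Set.mem_Icc,
        ENNReal.ofReal_le_iff_le_toReal he]
      tauto
    rw [this, Real.volume_Icc, sub_zero, ENNReal.ofReal_toReal he]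

variable {Ω : Type*} [MeasurableSpace Ω] {P : Measure Ω}

/-- Layer-cake formula for possibly infinite variables. The strict version here and the weak one
below serve the two inequalities in `IsQProcess.lintegral_hittingTime`, so the event of hitting
exactly at time `t` needs no analysis. -/
lemma lintegral_eq_lintegral_meas_lt' [SFinite P] {C : Ω → ℝ≥0∞} (hC : Measurable C) :
    ∫⁻ ω, C ω ∂P = ∫⁻ t in Set.Ici (0 : ℝ), P {ω | ENNReal.ofReal t < C ω} := by
  have hm : MeasurableSet {p : Ω × ℝ | ENNReal.ofReal p.2 < C p.1} :=
    measurableSet_lt (ENNReal.measurable_ofReal.comp measurable_snd) (hC.comp measurable_fst)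
  calc ∫⁻ ω, C ω ∂P
      = ∫⁻ ω, (∫⁻ t in Set.Ici (0 : ℝ),
          {p : Ω × ℝ | ENNReal.ofReal p.2 < C p.1}.indicator 1 (ω, t)) ∂P := by
        refine lintegral_congr fun ω => ?_
        exact (setLIntegral_indicator_lt (C ω)).symm
    _ = _ := by
        rw [lintegral_lintegral_swap (f := fun ω (t : ℝ) =>
            {p : Ω × ℝ | ENNReal.ofReal p.2 < C p.1}.indicator 1 (ω, t))
          ((measurable_one.indicator hm).aemeasurable)]
        refine lintegral_congr fun t => ?_
        rw [← lintegral_indicator_one (measurableSet_lt measurable_const hC)]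
        rfl

lemma lintegral_eq_lintegral_meas_le' [SFinite P] {C : Ω → ℝ≥0∞} (hC : Measurable C) :
    ∫⁻ ω, C ω ∂P = ∫⁻ t in Set.Ici (0 : ℝ), P {ω | ENNReal.ofReal t ≤ C ω} := by
  have hm : MeasurableSet {p : Ω × ℝ | ENNReal.ofReal p.2 ≤ C p.1} :=
    measurableSet_le (ENNReal.measurable_ofReal.comp measurable_snd) (hC.comp measurable_fst)
  calc ∫⁻ ω, C ω ∂P
      = ∫⁻ ω, (∫⁻ t in Set.Ici (0 : ℝ),
          {p : Ω × ℝ | ENNReal.ofReal p.2 ≤ C p.1}.indicator 1 (ω, t)) ∂P := by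
        refine lintegral_congr fun ω => ?_
        exact (setLIntegral_indicator_le (C ω)).symm
    _ = _ := by
        rw [lintegral_lintegral_swap (f := fun ω (t : ℝ) =>
            {p : Ω × ℝ | ENNReal.ofReal p.2 ≤ C p.1}.indicator 1 (ω, t))
          ((measurable_one.indicator hm).aemeasurable)]
        refine lintegral_congr fun t => ?_
        rw [← lintegral_indicator_one (measurableSet_le measurable_const hC)]
        rfl

variable {S : Type*} [DecidableEq S] {Q : S → S → ℝ} {i₀ : S} {M : ℝ≥0 → Ω → S}

lemma hittingTime_le {S Ω : Type*} {M : ℝ≥0 → Ω → S} {x : S} {t : ℝ≥0} {ω : Ω}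
    (h : M t ω = x) : hittingTime M x ω ≤ t :=
  iInf₂_le t h

/-- By right-continuity a state occupied at some time is still occupied at a slightly later time of
a countable dense set. Measurability and almost-sure arguments can then run over countably many
times. -/
lemma hittingTime_lt_iff (hM : IsQProcess Q i₀ P M) {x : S} {ω : Ω} {u : ℝ≥0∞} :
    hittingTime M x ω < u ↔
      ∃ s ∈ TopologicalSpace.denseSeq ℝ≥0 '' Set.univ, (s : ℝ≥0∞) < u ∧ M s ω = x := by
  constructor
  · intro h
    simp only [hittingTime, iInf_lt_iff] at h
    obtain ⟨t, ht, htu⟩ := h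
    have h1 : ∀ᶠ s in 𝓝[≥] t, M s ω = x := by
      filter_upwards [hM.rightContinuous ω t] with s hs
      rw [hs]; exact ht
    have h2 : ∀ᶠ s : ℝ≥0 in 𝓝[≥] t, (s : ℝ≥0∞) < u :=
      nhdsWithin_le_nhds ((ENNReal.continuous_coe.tendsto t).eventually (gt_mem_nhds htu))
    obtain ⟨v, hv, hv2⟩ := (mem_nhdsGE_iff_exists_Ico_subset' (lt_add_one t)).1 (h1.and h2)
    have hne : (Set.Ioo t v).Nonempty := Set.nonempty_Ioo.2 hv
    obtain ⟨s, hs2⟩ := (TopologicalSpace.denseRange_denseSeq ℝ≥0).exists_mem_open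
      isOpen_Ioo hne
    have := hv2 ⟨hs2.1.le, hs2.2⟩
    exact ⟨_, ⟨s, trivial, rfl⟩, this.2, this.1⟩
  · rintro ⟨s, -, hsu, hs⟩
    exact (hittingTime_le hs).trans_lt hsu

lemma measurable_hittingTime (hM : IsQProcess Q i₀ P M) (x : S) :
    Measurable (hittingTime M x) := by
  refine measurable_of_Iio fun u => ?_
  have : hittingTime M x ⁻¹' Set.Iio u =
      ⋃ s ∈ TopologicalSpace.denseSeq ℝ≥0 '' Set.univ, {ω | (s : ℝ≥0∞) < u ∧ M s ω = x} := by
    ext ω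
    simp only [Set.mem_preimage, Set.mem_Iio, hittingTime_lt_iff hM, Set.mem_iUnion,
      Set.mem_ofPred_eq, exists_prop]
  rw [this]
  refine MeasurableSet.biUnion (Set.countable_univ.image _) fun s _ => ?_
  exact (MeasurableSet.const _).inter (hM.measurableSet_eq s x)

/-- The finite-dimensional laws are prescribed only jointly with time 0, so the almost sure initial
condition is used to drop that coordinate. -/
lemma IsQProcess.measure_eq (hM : IsQProcess Q i₀ P M) (t : ℝ≥0) (x : S) :
    P {ω | M t ω = x} = transFun Q t i₀ x := by
  have := hM.isProbabilityMeasure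
  have h0 : P {ω | M 0 ω = i₀} = 1 := by
    have := hM.finDimDistr 0 (fun _ => 0) (fun _ => i₀) monotone_const rfl rfl
    simpa using this
  have h0' : ∀ᵐ ω ∂P, M 0 ω = i₀ := (prob_compl_eq_zero_iff (hM.measurableSet_eq 0 i₀)).2 h0
  have h1 := hM.finDimDistr 1 (fun k => if k = 0 then 0 else t) (fun k => if k = 0 then i₀ else x)
    (fun k l hkl => by
      dsimp only
      split_ifs with h1 h2
      · exact le_rfl
      · exact zero_le
      · omega
      · exact le_rfl) (by simp) (by simp)
  simp only [Finset.range_one, Finset.prod_singleton] at h1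
  simp only [zero_add, one_ne_zero, if_false, if_true, NNReal.coe_zero, sub_zero] at h1
  rw [← h1]
  refine measure_congr (eventuallyEq_set.2 ?_)
  filter_upwards [h0'] with ω hω
  refine ⟨fun h => ?_, fun h => ?_⟩
  · intro k hk
    interval_cases k
    · simpa using hω
    · simpa using h
  · simpa using h 1 le_rfl

/-- The joint law at times 0, `s`, `t` contains the factor `transFun Q (t - s) o x`, which is zero
for `x ≠ o`. -/
lemma IsQProcess.ae_of_absorbing [Countable S] (hM : IsQProcess Q i₀ P M) {o : S}
    (ho : ∀ k, Q o k = 0) {s t : ℝ≥0} (hst : s ≤ t) :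
    ∀ᵐ ω ∂P, M s ω = o → M t ω = o := by
  have := hM.isProbabilityMeasure
  have h0 : P {ω | M 0 ω = i₀} = 1 := by
    have := hM.finDimDistr 0 (fun _ => 0) (fun _ => i₀) monotone_const rfl rfl
    simpa using this
  have h0' : ∀ᵐ ω ∂P, M 0 ω = i₀ := (prob_compl_eq_zero_iff (hM.measurableSet_eq 0 i₀)).2 h0
  have h1 : ∀ x, x ≠ o → ∀ᵐ ω ∂P, M 0 ω = i₀ → ¬ (M s ω = o ∧ M t ω = x) := by
    intro x hx
    have h1 := hM.finDimDistr 2 (fun k => if k = 0 then 0 else if k = 1 then s else t)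
      (fun k => if k = 0 then i₀ else if k = 1 then o else x)
      (fun k l hkl => by
        dsimp only
        split_ifs <;> first | exact le_rfl | exact zero_le | exact hst | omega)
      (by simp) (by simp)
    simp only [Finset.prod_range_succ, Finset.range_zero, Finset.prod_empty, one_mul,
      zero_add, one_ne_zero, if_false, if_true, Nat.reduceAdd, OfNat.ofNat_ne_zero,
      OfNat.ofNat_ne_one] at h1
    rw [transFun_eq_zero_of_absorbing ho hx, mul_zero] at h1
    have h2 : ∀ᵐ ω ∂P, ω ∉ {ω | ∀ k ≤ 2, M (if k = 0 then 0 else if k = 1 then s else t) ω =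
        if k = 0 then i₀ else if k = 1 then o else x} := measure_eq_zero_iff_ae_notMem.1 h1
    filter_upwards [h2] with ω hω h0 hω2
    refine hω fun k hk => ?_
    interval_cases k
    · simpa using h0
    · simpa using hω2.1
    · simpa using hω2.2
  have h2 : ∀ᵐ ω ∂P, ∀ x, x ≠ o → M 0 ω = i₀ → ¬ (M s ω = o ∧ M t ω = x) := by
    rw [ae_all_iff]
    intro x
    by_cases hx : x = o
    · simp [hx]
    · filter_upwards [h1 x hx] with ω hω _ using hω
  filter_upwards [h0', h2] with ω hω hω2 hs
  by_contra h
  exact hω2 _ h hω ⟨hs, rfl⟩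

/-- The expected hitting time of an absorbing state is the integral of the survival function. -/
lemma IsQProcess.lintegral_hittingTime [Countable S] (hM : IsQProcess Q i₀ P M) {o : S}
    (ho : ∀ k, Q o k = 0) :
    ∫⁻ ω, hittingTime M o ω ∂P =
      ∫⁻ t in Set.Ici (0 : ℝ), P {ω | M t.toNNReal ω ≠ o} := by
  have := hM.isProbabilityMeasure
  have hm := measurable_hittingTime hM o
  refine le_antisymm ?_ ?_
  · rw [lintegral_eq_lintegral_meas_lt' hm]
    refine lintegral_mono fun t => measure_mono fun ω hω h => ?_
    exact absurd (hittingTime_le h) (not_le.2 hω)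
  -- If the hitting time is less than `t`, the state is visited at a dense time before `t`, and
  -- absorption, almost surely valid for all dense times at once, keeps it there.
  · rw [lintegral_eq_lintegral_meas_le' hm]
    refine lintegral_mono fun t => measure_mono_ae ?_
    have h1 : ∀ᵐ ω ∂P, ∀ s ∈ TopologicalSpace.denseSeq ℝ≥0 '' Set.univ, s ≤ t.toNNReal →
        M s ω = o → M t.toNNReal ω = o := by
      rw [ae_ball_iff (Set.countable_univ.image _)]
      intro s _
      by_cases hs : s ≤ t.toNNReal
      · filter_upwards [hM.ae_of_absorbing ho hs] with ω hω _ using hω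
      · simp [hs]
    filter_upwards [h1] with ω hω h2
    by_contra h3
    obtain ⟨s, hs, hst, hso⟩ := (hittingTime_lt_iff hM).1 (not_le.1 h3)
    exact h2 (hω s hs (ENNReal.coe_le_coe.1 hst.le) hso)

lemma tsum_option_eq (f : Option ℕ → ℝ≥0∞) : ∑' x, f x = f none + ∑' k, f (some k) := by
  rw [← (Equiv.optionEquivSumPUnit.{0} ℕ).symm.tsum_eq f,
    ENNReal.summable.tsum_sum ENNReal.summable]
  simp [add_comm]

/-- The expected absorption time as the minimal solution of the first-step equations. -/
lemma IsQProcess.lintegral_hittingTime_eq_minSol {Q : Option ℕ → Option ℕ → ℝ} {i₀ : Option ℕ}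
    {M : ℝ≥0 → Ω → Option ℕ} (hM : IsQProcess Q i₀ P M) (ho : ∀ k, Q none k = 0)
    (hQ : ∀ i, i ≠ none → Q i i < 0) :
    ∫⁻ ω, hittingTime M none ω ∂P =
      minSol (exitRate Q none) (offDiag Q) (fun x => if x = none then 0 else 1) i₀ := by
  rw [hM.lintegral_hittingTime ho, minSol_eq_tsum_single]
  have h1 : ∀ t ∈ Set.Ici (0 : ℝ), P {ω | M t.toNNReal ω ≠ none} =
      ∑' k : ℕ, transFun Q t i₀ (some k) := by
    intro t ht
    have : {ω | M t.toNNReal ω ≠ none} = ⋃ k : ℕ, {ω | M t.toNNReal ω = some k} := by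
      ext ω
      simp [Option.ne_none_iff_exists']
    rw [this, measure_iUnion]
    · congr 1; ext k
      rw [hM.measure_eq, Real.coe_toNNReal _ ht]
    · intro k l hkl
      rw [Function.onFun, Set.disjoint_left]
      rintro ω h1 h2
      simp only [Set.mem_ofPred_eq] at h1 h2
      rw [h1] at h2
      exact hkl (Option.some.inj h2)
    · exact fun k => hM.measurableSet_eq _ _
  rw [setLIntegral_congr_fun measurableSet_Ici h1,
    lintegral_tsum fun k => (measurable_transFun _ _).aemeasurable, tsum_option_eq]
  simp only [if_true, zero_mul, zero_add, reduceCtorEq, if_false, one_mul]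
  congr 1; ext k
  exact lintegral_transFun ho hQ (by simp) i₀

end Hitting

/-! ### The first-step equations of the queue -/

section Queue

/-- Departure rate in state `i`. -/
noncomputable def downRate (c : ℕ) (b : ℕ → ℝ) (i : ℕ) : ℝ≥0∞ :=
  ENNReal.ofReal (((min i c : ℕ) : ℝ) * b 0)

/-- Arrival rate of batches of size `j + 1`. -/
noncomputable def upRate (b : ℕ → ℝ) (j : ℕ) : ℝ≥0∞ := ENNReal.ofReal (b (j + 2))

/-- Total arrival rate. -/
noncomputable def upTotal (b : ℕ → ℝ) : ℝ≥0∞ := ∑' j, upRate b j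

/-- Total exit rate of state `i ≥ 1`. -/
noncomputable def baseRate (c : ℕ) (b : ℕ → ℝ) (i : ℕ) : ℝ≥0∞ :=
  if i = 0 then 1 else downRate c b i + upTotal b

/-- Jump rates of the stopped queue. -/
noncomputable def jump (c : ℕ) (b : ℕ → ℝ) : ℕ → ℕ → ℝ≥0∞ := offDiag (Qstar c b)

/-- Indicator function of the states `i ≥ 1`. -/
noncomputable def busy (i : ℕ) : ℝ≥0∞ := if i = 0 then 0 else 1

/-- Exit rates of the stopped queue which is killed at rate `β` in the states `i ≥ 1`. -/
noncomputable def killedRate (c : ℕ) (b : ℕ → ℝ) (β : ℝ) (i : ℕ) : ℝ≥0∞ :=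
  baseRate c b i + ENNReal.ofReal β * busy i

/-- Probability that the queue empties before it is killed. -/
noncomputable def emptyProb (c : ℕ) (b : ℕ → ℝ) (β : ℝ) (i : ℕ) : ℝ≥0∞ :=
  minSol (killedRate c b β) (jump c b) (Pi.single 0 1) i

/-- Expected time until the queue empties or is killed. -/
noncomputable def busyTime (c : ℕ) (b : ℕ → ℝ) (β : ℝ) (i : ℕ) : ℝ≥0∞ :=
  minSol (killedRate c b β) (jump c b) busy i

variable {c : ℕ} {b h : ℕ → ℝ}

lemma IsModel.hasSum_b_tail (hm : IsModel c b h) : HasSum (fun j => b (j + 2)) (-b 1 - b 0) := by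
  have h1 := (hasSum_nat_add_iff' 2).2 hm.b_conservative
  simpa [Finset.sum_range_succ] using h1

lemma IsModel.upTotal_eq (hm : IsModel c b h) : upTotal b = ENNReal.ofReal (-b 1 - b 0) := by
  rw [← hm.hasSum_b_tail.tsum_eq, ENNReal.ofReal_tsum_of_nonneg
    (fun j => hm.b_nonneg _ (by omega)) hm.hasSum_b_tail.summable]
  rfl

lemma IsModel.upTotal_nonneg (hm : IsModel c b h) : 0 ≤ -b 1 - b 0 :=
  hm.hasSum_b_tail.nonneg fun j => hm.b_nonneg _ (by omega)

lemma IsModel.upTotal_ne_top (hm : IsModel c b h) : upTotal b ≠ ∞ := by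
  rw [hm.upTotal_eq]; exact ENNReal.ofReal_ne_top

lemma downRate_ne_top (i : ℕ) : downRate c b i ≠ ∞ := ENNReal.ofReal_ne_top

lemma IsModel.le_downRate (hm : IsModel c b h) {i : ℕ} (hi : i ≠ 0) :
    ENNReal.ofReal (b 0) ≤ downRate c b i := by
  refine ENNReal.ofReal_le_ofReal ?_
  have h1 : 1 ≤ min i c := le_min (Nat.one_le_iff_ne_zero.2 hi) hm.one_le_c
  have h2 : (1 : ℝ) ≤ ((min i c : ℕ) : ℝ) := by exact_mod_cast h1
  nlinarith [hm.b_zero_pos]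

lemma IsModel.downRate_one (hm : IsModel c b h) : downRate c b 1 = ENNReal.ofReal (b 0) := by
  rw [downRate, min_eq_left hm.one_le_c]; simp

lemma IsModel.downRate_le (hm : IsModel c b h) (i : ℕ) :
    downRate c b i ≤ ENNReal.ofReal (c * b 0) := by
  refine ENNReal.ofReal_le_ofReal ?_
  have h2 : ((min i c : ℕ) : ℝ) ≤ c := by exact_mod_cast min_le_right _ _
  exact mul_le_mul_of_nonneg_right h2 hm.b_zero_pos.le

lemma IsModel.ofReal_b_zero_ne_zero (hm : IsModel c b h) : ENNReal.ofReal (b 0) ≠ 0 := by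
  simpa using hm.b_zero_pos

lemma IsModel.baseRate_ne_zero (hm : IsModel c b h) (i : ℕ) : baseRate c b i ≠ 0 := by
  unfold baseRate
  split_ifs with hi
  · exact one_ne_zero
  · have := (hm.ofReal_b_zero_ne_zero.bot_lt.trans_le (hm.le_downRate hi)).ne'
    intro h0
    exact this (add_eq_zero.1 h0).1

lemma IsModel.baseRate_ne_top (hm : IsModel c b h) (i : ℕ) : baseRate c b i ≠ ∞ := by
  unfold baseRate
  split_ifs with hi
  · exact ENNReal.one_ne_top
  · exact ENNReal.add_ne_top.2 ⟨downRate_ne_top i, hm.upTotal_ne_top⟩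

lemma busy_ne_top (i : ℕ) : busy i ≠ ∞ := by unfold busy; split_ifs <;> simp

lemma IsModel.killedRate_ne_zero (hm : IsModel c b h) (β : ℝ) (i : ℕ) :
    killedRate c b β i ≠ 0 := fun h0 => hm.baseRate_ne_zero i (add_eq_zero.1 h0).1

lemma IsModel.killedRate_ne_top (hm : IsModel c b h) (β : ℝ) (i : ℕ) :
    killedRate c b β i ≠ ∞ :=
  ENNReal.add_ne_top.2 ⟨hm.baseRate_ne_top i,
    ENNReal.mul_ne_top ENNReal.ofReal_ne_top (busy_ne_top i)⟩

lemma jump_ne_top (i l : ℕ) : jump c b i l ≠ ∞ := by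
  unfold jump offDiag; split_ifs <;> simp

@[simp] lemma jump_zero (l : ℕ) : jump c b 0 l = 0 := by
  simp [jump, offDiag, Qstar]

@[simp] lemma busy_zero : busy 0 = 0 := rfl

@[simp] lemma busy_succ (i : ℕ) : busy (i + 1) = 1 := rfl

@[simp] lemma killedRate_zero_left : killedRate c b 0 = baseRate c b := by
  ext i; simp [killedRate]

@[simp] lemma killedRate_zero (β : ℝ) : killedRate c b β 0 = 1 := by simp [killedRate, baseRate]

lemma killedRate_succ (β : ℝ) (i : ℕ) :
    killedRate c b β (i + 1) = downRate c b (i + 1) + upTotal b + ENNReal.ofReal β := by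
  simp [killedRate, baseRate]

lemma jump_down (i : ℕ) : jump c b (i + 1) i = downRate c b (i + 1) := by
  simp [jump, offDiag, Qstar, downRate]

lemma jump_up (i j : ℕ) : jump c b (i + 1) (j + (i + 2)) = upRate b j := by
  have h1 : j + (i + 2) - (i + 1) + 1 = j + 2 := by omega
  rw [jump, offDiag, if_neg (by omega), Qstar, if_neg (by omega), if_neg (by omega),
    if_neg (by omega), if_pos (by omega), h1, upRate]

lemma jump_eq_zero {i l : ℕ} (hl : l < i) : jump c b (i + 1) l = 0 := by
  rw [jump, offDiag, if_neg (by omega), Qstar, if_neg (by omega), if_neg (by omega),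
    if_neg (by omega), if_neg (by omega), ENNReal.ofReal_zero]

lemma jump_self (i : ℕ) : jump c b i i = 0 := by simp [jump, offDiag]

/-- The queue is skip-free downwards: one departure, or a batch of size `j + 1`. -/
lemma tsum_jump (x : ℕ → ℝ≥0∞) (i : ℕ) :
    ∑' l, jump c b (i + 1) l * x l =
      downRate c b (i + 1) * x i + ∑' j, upRate b j * x (j + (i + 2)) := by
  rw [← Summable.sum_add_tsum_nat_add' (f := fun l => jump c b (i + 1) l * x l) (k := i + 2)
    ENNReal.summable]
  congr 1
  · rw [Finset.sum_range_succ, Finset.sum_range_succ, jump_self, jump_down, Finset.sum_eq_zero]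
    · simp
    · intro l hl
      rw [jump_eq_zero (Finset.mem_range.1 hl), zero_mul]
  · congr 1; ext j; rw [jump_up]

lemma tsum_jump_const (K : ℝ≥0∞) (i : ℕ) :
    ∑' l, jump c b (i + 1) l * K = (downRate c b (i + 1) + upTotal b) * K := by
  rw [tsum_jump (fun _ => K), ENNReal.tsum_mul_right, add_mul, upTotal]

/-- The constant function `1` solves the equations with sources `1` at `0` and `β` elsewhere. -/
lemma killedRate_mul_one (β : ℝ) (i : ℕ) :
    killedRate c b β i * 1 =
      ((Pi.single 0 1 : ℕ → ℝ≥0∞) i + ENNReal.ofReal β * busy i) + ∑' l, jump c b i l * 1 := by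
  cases i with
  | zero => simp
  | succ i => rw [tsum_jump_const, killedRate_succ]; simp; ring

/-- Bounded solutions are unique if the killing rate is positive. -/
lemma IsModel.eq_minSol_of_bounded (hm : IsModel c b h) {β : ℝ} (hβ : 0 < β) {x γ : ℕ → ℝ≥0∞}
    (hx : ∀ i, killedRate c b β i * x i = γ i + ∑' l, jump c b i l * x l) {K : ℝ≥0∞} (hK : K ≠ ∞)
    (hxK : ∀ i, x i ≤ K) (i : ℕ) : x i = minSol (killedRate c b β) (jump c b) γ i := by
  have hβ0 : ENNReal.ofReal β ≠ 0 := by simpa using hβ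
  have hd0 := hm.killedRate_ne_zero β
  have hd := hm.killedRate_ne_top β
  refine le_antisymm ?_ (minSol_le hd0 hd (fun i => (hx i).ge) i)
  -- Comparison source for `le_minSol`: its minimal solution is at most 1 and, the rates being
  -- bounded, at least β / R, so a multiple of it dominates every bounded function.
  set γ' : ℕ → ℝ≥0∞ := fun i => (Pi.single 0 1 : ℕ → ℝ≥0∞) i + ENNReal.ofReal β * busy i with hγ'
  have hone : ∀ i, minSol (killedRate c b β) (jump c b) γ' i ≤ 1 :=
    minSol_le (x := fun _ => 1) hd0 hd (fun i => (killedRate_mul_one β i).ge)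
  set R := ENNReal.ofReal (c * b 0) + upTotal b + ENNReal.ofReal β
  have hR : R ≠ ∞ := by
    exact ENNReal.add_ne_top.2 ⟨ENNReal.add_ne_top.2 ⟨ENNReal.ofReal_ne_top, hm.upTotal_ne_top⟩,
      ENNReal.ofReal_ne_top⟩
  have hge : ∀ i, 1 ≤ R / ENNReal.ofReal β * minSol (killedRate c b β) (jump c b) γ' i := by
    intro i
    have h1 : ENNReal.ofReal β / R ≤ minSol (killedRate c b β) (jump c b) γ' i := by
      rw [minSol_eq_step]
      refine le_trans ?_ le_self_add
      cases i with
      | zero =>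
        simp only [hγ', killedRate_zero, Pi.single_eq_same, busy_zero, mul_zero, add_zero, div_one]
        exact ENNReal.div_le_of_le_mul (by rw [one_mul]; exact le_add_self)
      | succ i =>
        rw [killedRate_succ]
        simp only [hγ', busy_succ, mul_one, ne_eq, Nat.add_eq_zero_iff, one_ne_zero, and_false,
          not_false_eq_true, Pi.single_eq_of_ne, zero_add]
        gcongr
        simp only [R]
        gcongr
        exact hm.downRate_le _
    calc (1 : ℝ≥0∞) = R / ENNReal.ofReal β * (ENNReal.ofReal β / R) := by
          rw [← ENNReal.inv_div (Or.inr ENNReal.ofReal_ne_top) (Or.inr hβ0)]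
          refine (ENNReal.inv_mul_cancel ?_ ?_).symm
          · exact ENNReal.div_ne_zero.2 ⟨hβ0, hR⟩
          · refine (ENNReal.div_lt_top ENNReal.ofReal_ne_top ?_).ne
            intro h0
            exact hβ0 (add_eq_zero.1 h0).2
      _ ≤ _ := by gcongr
  refine le_minSol (γ' := γ') (C := K * (R / ENNReal.ofReal β)) hd0 hd (fun i => (hx i).le)
    (ENNReal.mul_ne_top hK (ENNReal.div_lt_top hR hβ0).ne) (fun i => ?_) i
    ((hone i).trans_lt ENNReal.one_lt_top).ne
  calc x i ≤ K * 1 := by rw [mul_one]; exact hxK i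
    _ ≤ K * (R / ENNReal.ofReal β * minSol (killedRate c b β) (jump c b) γ' i) := by
        gcongr; exact hge i
    _ = _ := by ring

/-- Under killing at a positive rate the queue surely ends, by emptying or by being killed: the
constant 1 is a bounded solution, and bounded solutions are unique. -/
lemma IsModel.emptyProb_add_busyTime (hm : IsModel c b h) {β : ℝ} (hβ : 0 < β) (i : ℕ) :
    emptyProb c b β i + ENNReal.ofReal β * busyTime c b β i = 1 := by
  have := hm.eq_minSol_of_bounded hβ (x := fun _ => 1) (fun i => killedRate_mul_one β i)
    ENNReal.one_ne_top (fun _ => le_rfl) i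
  rw [this, minSol_add, minSol_const_mul]; rfl

lemma IsModel.emptyProb_le_one (hm : IsModel c b h) (β : ℝ) (i : ℕ) : emptyProb c b β i ≤ 1 := by
  refine minSol_le (x := fun _ => 1) (hm.killedRate_ne_zero β) (hm.killedRate_ne_top β)
    (fun i => ?_) i
  rw [killedRate_mul_one]
  gcongr
  exact le_self_add

lemma IsModel.killedRate_mul_emptyProb (hm : IsModel c b h) (β : ℝ) (i : ℕ) :
    killedRate c b β (i + 1) * emptyProb c b β (i + 1) =
      ∑' l, jump c b (i + 1) l * emptyProb c b β l := by
  have := mul_minSol (a := jump c b) (γ := Pi.single 0 1) (hm.killedRate_ne_zero β)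
    (hm.killedRate_ne_top β) (i + 1)
  simpa [emptyProb] using this

@[simp] lemma IsModel.emptyProb_zero (hm : IsModel c b h) (β : ℝ) : emptyProb c b β 0 = 1 := by
  have := mul_minSol (a := jump c b) (γ := Pi.single 0 1) (hm.killedRate_ne_zero β)
    (hm.killedRate_ne_top β) 0
  simpa [emptyProb] using this

lemma IsModel.tendsto_minSol_killedRate (hm : IsModel c b h) (γ : ℕ → ℝ≥0∞) (i : ℕ) :
    Tendsto (fun β => minSol (killedRate c b β) (jump c b) γ i) (𝓝[>] 0)
      (𝓝 (minSol (killedRate c b 0) (jump c b) γ i)) := by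
  rw [killedRate_zero_left]
  exact tendsto_minSol hm.baseRate_ne_zero hm.baseRate_ne_top busy_ne_top jump_ne_top i

lemma IsModel.tendsto_tsum_minSol_killedRate (hm : IsModel c b h) (γ : ℕ → ℝ≥0∞)
    {w : ℕ → ℝ≥0∞} (hw : ∀ i, w i ≠ ∞) :
    Tendsto (fun β => ∑' i, w i * minSol (killedRate c b β) (jump c b) γ i) (𝓝[>] 0)
      (𝓝 (∑' i, w i * minSol (killedRate c b 0) (jump c b) γ i)) := by
  rw [killedRate_zero_left]
  exact tendsto_tsum_minSol hm.baseRate_ne_zero hm.baseRate_ne_top busy_ne_top jump_ne_top hw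

lemma IsModel.exitRate_Qstar (hm : IsModel c b h) : exitRate (Qstar c b) 0 = baseRate c b := by
  ext i
  unfold exitRate baseRate
  split_ifs with hi
  · rfl
  · rw [hm.upTotal_eq, downRate, ← ENNReal.ofReal_add
      (mul_nonneg (Nat.cast_nonneg _) hm.b_zero_pos.le) hm.upTotal_nonneg]
    congr 1
    rw [Qstar, if_neg hi, if_neg (by omega), if_pos rfl]
    ring

lemma IsModel.Qstar_self_neg (hm : IsModel c b h) {i : ℕ} (hi : i ≠ 0) : Qstar c b i i < 0 := by
  have h1 := hm.baseRate_ne_zero i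
  rw [← hm.exitRate_Qstar, exitRate, if_neg hi] at h1
  simpa using h1

lemma Qstar_zero (k : ℕ) : Qstar c b 0 k = 0 := by simp [Qstar]

lemma IsModel.mstar_eq (hm : IsModel c b h) {i : ℕ} (hi : i ≠ 0) (k : ℕ) :
    mstar c b i k = minSol (killedRate c b 0) (jump c b) (Pi.single i 1) k := by
  rw [mstar, lintegral_transFun (o := 0) Qstar_zero (fun i hi => hm.Qstar_self_neg hi) hi,
    hm.exitRate_Qstar, killedRate_zero_left]
  rfl

/-! ### The queue with restarts: first-step equations of the catastrophe time. -/

/-- Total rate of the arrivals at the empty system. -/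
noncomputable def restartTotal (h : ℕ → ℝ) : ℝ≥0∞ := ENNReal.ofReal (∑' j, h j)

lemma IsModel.tsum_restart (hm : IsModel c b h) :
    ∑' l, ENNReal.ofReal (h l) = restartTotal h :=
  (ENNReal.ofReal_tsum_of_nonneg hm.h_nonneg hm.h_summable).symm

lemma IsModel.restartTotal_ne_zero (hm : IsModel c b h) : restartTotal h ≠ 0 := by
  simpa [restartTotal] using hm.h_pos

/-- The first-step equations for the expected catastrophe times `E`, and an upper bound. -/
structure IsCatastropheTime (c : ℕ) (b h : ℕ → ℝ) (β : ℝ) (E : ℕ → ℝ≥0∞) : Prop where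
  zero : restartTotal h * E 0 = 1 + ∑' l, ENNReal.ofReal (h l) * E l
  succ : ∀ i, killedRate c b β (i + 1) * E (i + 1) = 1 + ∑' l, jump c b (i + 1) l * E l
  zero_le : E 0 ≤ (restartTotal h)⁻¹ +
    (1 + ENNReal.ofReal (b 0) / restartTotal h) / ENNReal.ofReal β
  succ_le : ∀ i, E (i + 1) ≤ (1 + ENNReal.ofReal (b 0) / restartTotal h) / ENNReal.ofReal β

lemma QM_none (β : ℝ) (k : Option ℕ) : QM c b h β none k = 0 := by
  cases k <;> simp [QM, extendZero, QdBar]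

lemma QM_zero_some (hm : IsModel c b h) (β : ℝ) (l : ℕ) :
    offDiag (QM c b h β) (some 0) (some l) = ENNReal.ofReal (h l) := by
  cases l with
  | zero => simp [offDiag, hm.h_zero]
  | succ l => simp [offDiag, QM, extendZero, QdBar, Qstar, Qs]

lemma QM_succ_some (β : ℝ) (i l : ℕ) :
    offDiag (QM c b h β) (some (i + 1)) (some l) = jump c b (i + 1) l := by
  by_cases hl : l = i + 1
  · simp [offDiag, jump, hl]
  · simp [offDiag, jump, hl, QM, extendZero, QdBar, Qs]

lemma exitRate_QM_zero (β : ℝ) :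
    exitRate (QM c b h β) none (some 0) = restartTotal h := by
  simp [exitRate, QM, extendZero, QdBar, Qs, Qstar, restartTotal]

lemma exitRate_QM_succ (hm : IsModel c b h) {β : ℝ} (hβ : 0 < β) (i : ℕ) :
    exitRate (QM c b h β) none (some (i + 1)) = killedRate c b β (i + 1) := by
  have h1 : baseRate c b (i + 1) = ENNReal.ofReal (-Qstar c b (i + 1) (i + 1)) := by
    rw [← hm.exitRate_Qstar]; simp [exitRate]
  rw [killedRate, busy_succ, mul_one, h1, ← ENNReal.ofReal_add
    (neg_nonneg.2 (hm.Qstar_self_neg (Nat.succ_ne_zero i)).le) hβ.le]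
  simp [exitRate, QM, extendZero, QdBar, Qs]
  ring_nf

/-- The equations are those of the minimal solution on the extended state space, where `none`
contributes 0; the bounds come from an explicit supersolution. -/
lemma IsModel.isCatastropheTime (hm : IsModel c b h) {β : ℝ} (hβ : 0 < β) {Ω : ℕ → Type*}
    [∀ j, MeasurableSpace (Ω j)] {P : ∀ j, Measure (Ω j)} {M : ∀ j, ℝ≥0 → Ω j → Option ℕ}
    (hM : ∀ j, IsQProcess (QM c b h β) (some j) (P j) (M j)) :
    IsCatastropheTime c b h β fun j => ∫⁻ ω, hittingTime (M j) none ω ∂(P j) := by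
  have hβ0 : ENNReal.ofReal β ≠ 0 := by simpa using hβ
  have hH := hm.restartTotal_ne_zero
  have hHt : restartTotal h ≠ ∞ := ENNReal.ofReal_ne_top
  have hd0 : ∀ x, exitRate (QM c b h β) none x ≠ 0 := by
    rintro (_ | _ | i)
    · simp [exitRate]
    · rwa [exitRate_QM_zero]
    · rw [exitRate_QM_succ hm hβ]; exact hm.killedRate_ne_zero _ _
  have hd : ∀ x, exitRate (QM c b h β) none x ≠ ∞ := by
    intro x; unfold exitRate; split_ifs <;> simp
  have hQ : ∀ x, x ≠ none → QM c b h β x x < 0 := by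
    intro x hx
    have := hd0 x
    rw [exitRate, if_neg hx] at this
    simpa using this
  set X := minSol (exitRate (QM c b h β) none) (offDiag (QM c b h β))
    (fun x => if x = none then 0 else 1) with hX
  have hE : (fun j => ∫⁻ ω, hittingTime (M j) none ω ∂(P j)) = fun j => X (some j) := by
    ext j
    exact (hM j).lintegral_hittingTime_eq_minSol (QM_none β) hQ
  have hnone : ∀ x, offDiag (QM c b h β) none x = 0 := by
    intro x; simp [offDiag, QM_none]
  have hXnone : X none = 0 := by
    rw [hX, minSol_eq_step, step]
    simp [hnone]
  have heq := fun x => mul_minSol (a := offDiag (QM c b h β))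
    (γ := fun x : Option ℕ => if x = none then (0 : ℝ≥0∞) else 1) hd0 hd x
  -- With value `K` on all states `i ≥ 1` and `1/h + K` at 0, this choice makes the first-step
  -- equations at 0 and at 1 exact; higher states have slack.
  set K := (1 + ENNReal.ofReal (b 0) / restartTotal h) / ENNReal.ofReal β with hK
  have hβK : ENNReal.ofReal β * K = 1 + ENNReal.ofReal (b 0) / restartTotal h :=
    ENNReal.mul_div_cancel hβ0 ENNReal.ofReal_ne_top
  set W : Option ℕ → ℝ≥0∞ := fun x => match x with
    | none => 0
    | some 0 => (restartTotal h)⁻¹ + K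
    | some (_ + 1) => K with hW
  have hXW : ∀ x, X x ≤ W x := by
    refine minSol_le hd0 hd ?_
    rintro (_ | _ | i)
    · simp [hnone]
    · rw [exitRate_QM_zero, tsum_option_eq]
      simp only [QM_zero_some hm]
      have h1 : ∀ l, ENNReal.ofReal (h l) * W (some l) = ENNReal.ofReal (h l) * K := by
        intro l
        cases l with
        | zero => simp [hm.h_zero]
        | succ l => rfl
      simp only [h1, ENNReal.tsum_mul_right, hm.tsum_restart]
      simp only [hW, mul_zero, zero_add, reduceCtorEq, if_false]
      rw [mul_add, ENNReal.mul_inv_cancel hH hHt]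
    · rw [exitRate_QM_succ hm hβ, tsum_option_eq]
      simp only [QM_succ_some]
      rw [tsum_jump (fun l => W (some l)), killedRate_succ]
      have h1 : ∑' j, upRate b j * W (some (j + (i + 2))) = upTotal b * K := by
        rw [upTotal, ← ENNReal.tsum_mul_right]
      rw [h1]
      cases i with
      | zero =>
        simp only [hW, mul_zero, zero_add, reduceCtorEq, if_false]
        rw [hm.downRate_one, add_mul, hβK]
        apply le_of_eq
        simp only [div_eq_mul_inv]
        ring
      | succ i =>
        simp only [hW, mul_zero, zero_add, reduceCtorEq, if_false]
        rw [add_mul, hβK, add_mul]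
        calc 1 + (downRate c b (i + 1 + 1) * K + upTotal b * K)
            ≤ (1 + ENNReal.ofReal (b 0) / restartTotal h) +
              (downRate c b (i + 1 + 1) * K + upTotal b * K) := by gcongr; exact le_self_add
          _ = _ := by ring
  rw [hE]
  refine ⟨?_, fun i => ?_, hXW (some 0), fun i => hXW (some (i + 1))⟩
  · have := heq (some 0)
    rw [exitRate_QM_zero, tsum_option_eq] at this
    simp only [QM_zero_some hm, ← hX, hXnone] at this
    simpa using this
  · have := heq (some (i + 1))
    rw [exitRate_QM_succ hm hβ, tsum_option_eq] at this
    simp only [QM_succ_some, ← hX, hXnone] at this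
    simpa using this

end Queue

/-! ### Forward equations and finiteness of the Green function. -/

section Finiteness

/-- The forward equation for the Green function. -/
lemma mul_minSol_single {S : Type*} [DecidableEq S] {d : S → ℝ≥0∞} {a : S → S → ℝ≥0∞}
    (hd0 : ∀ i, d i ≠ 0) (hd : ∀ i, d i ≠ ∞) (j k : S) :
    d j * minSol d a (Pi.single j 1) k =
      (Pi.single j 1 : S → ℝ≥0∞) k + ∑' i, a i j * minSol d a (Pi.single i 1) k := by
  -- The shifted source is column `j` of the matrix, rescaled; it is then expanded over point
  -- sources.
  have h1 : (fun i => ∑' l, a i l * ((Pi.single j 1 : S → ℝ≥0∞) l / d l)) =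
      fun i => (d j)⁻¹ * a i j := by
    ext i
    rw [tsum_eq_single j]
    · simp [mul_comm]
    · intro l hl
      simp [hl]
  rw [minSol_eq_add_minSol, h1, minSol_const_mul, mul_add, ← mul_assoc,
    ENNReal.mul_inv_cancel (hd0 j) (hd j), one_mul, minSol_eq_tsum_single]
  congr 1
  by_cases hk : k = j
  · subst hk
    rw [ENNReal.mul_div_cancel (hd0 k) (hd k)]
  · simp [hk]

variable {c : ℕ} {b h : ℕ → ℝ}

/-- The Green function of the stopped queue. -/
noncomputable def green (c : ℕ) (b : ℕ → ℝ) (i k : ℕ) : ℝ≥0∞ :=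
  minSol (killedRate c b 0) (jump c b) (Pi.single i 1) k

lemma IsModel.green_forward (hm : IsModel c b h) (j k : ℕ) :
    killedRate c b 0 j * green c b j k =
      (Pi.single j 1 : ℕ → ℝ≥0∞) k + ∑' i, jump c b i j * green c b i k :=
  mul_minSol_single (hm.killedRate_ne_zero 0) (hm.killedRate_ne_top 0) j k

lemma emptyProb_zero_rate (k : ℕ) : emptyProb c b 0 k = green c b 0 k := rfl

/-- The queue can only empty by a departure from state `1`. -/
lemma IsModel.emptyProb_eq (hm : IsModel c b h) {k : ℕ} (hk : k ≠ 0) :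
    emptyProb c b 0 k = ENNReal.ofReal (b 0) * green c b 1 k := by
  have h1 := hm.green_forward 0 k
  rw [killedRate_zero, one_mul, tsum_eq_single 1, jump_down, hm.downRate_one] at h1
  · simpa [hk, emptyProb_zero_rate] using h1
  · rintro (_ | _ | i) hi
    · simp
    · exact absurd rfl hi
    · rw [jump_eq_zero (Nat.succ_pos i), zero_mul]

/-- The forward equation at 0 bounds the flow from 1 into 0 by the probability of emptying. -/
lemma IsModel.mul_green_one_le_one (hm : IsModel c b h) (k : ℕ) :
    ENNReal.ofReal (b 0) * green c b 1 k ≤ 1 := by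
  have h1 := hm.green_forward 0 k
  have h2 : jump c b 1 0 * green c b 1 k ≤ ∑' i, jump c b i 0 * green c b i k :=
    ENNReal.le_tsum 1
  rw [jump_down, hm.downRate_one] at h2
  calc _ ≤ _ := h2
    _ ≤ killedRate c b 0 0 * green c b 0 k := by rw [h1]; exact le_add_self
    _ = emptyProb c b 0 k := by rw [killedRate_zero, one_mul]; rfl
    _ ≤ 1 := hm.emptyProb_le_one 0 k

/-- Induction on the target: by the forward equation the flow from `i + 2` down to `i + 1` is at
most the total flow out of `i + 1`. The bound is uniform in the starting state, so it survives
averaging over `h`. -/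
lemma IsModel.exists_green_le (hm : IsModel c b h) (i : ℕ) :
    ∃ C : ℝ≥0∞, C ≠ ∞ ∧ ∀ k, green c b (i + 1) k ≤ C := by
  have hb := hm.ofReal_b_zero_ne_zero
  have hdiv : ∀ x y : ℝ≥0∞, ENNReal.ofReal (b 0) * x ≤ y → x ≤ y / ENNReal.ofReal (b 0) := by
    intro x y hxy
    rw [ENNReal.le_div_iff_mul_le (Or.inl hb) (Or.inl ENNReal.ofReal_ne_top), mul_comm]
    exact hxy
  induction i with
  | zero =>
    exact ⟨1 / ENNReal.ofReal (b 0), (ENNReal.div_lt_top ENNReal.one_ne_top hb).ne,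
      fun k => hdiv _ _ (hm.mul_green_one_le_one k)⟩
  | succ i ih =>
    obtain ⟨C, hC, hle⟩ := ih
    refine ⟨killedRate c b 0 (i + 1) * C / ENNReal.ofReal (b 0),
      (ENNReal.div_lt_top (ENNReal.mul_ne_top (hm.killedRate_ne_top 0 _) hC) hb).ne,
      fun k => hdiv _ _ ?_⟩
    calc ENNReal.ofReal (b 0) * green c b (i + 1 + 1) k
        ≤ jump c b (i + 1 + 1) (i + 1) * green c b (i + 1 + 1) k := by
          rw [jump_down]; gcongr; exact hm.le_downRate (by omega)
      _ ≤ ∑' l, jump c b l (i + 1) * green c b l k := ENNReal.le_tsum (i + 1 + 1)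
      _ ≤ killedRate c b 0 (i + 1) * green c b (i + 1) k := by
          rw [hm.green_forward]; exact le_add_self
      _ ≤ _ := by gcongr; exact hle k

lemma IsModel.green_ne_top (hm : IsModel c b h) {i : ℕ} (hi : i ≠ 0) (k : ℕ) :
    green c b i k ≠ ∞ := by
  obtain ⟨i, rfl⟩ := Nat.exists_eq_succ_of_ne_zero hi
  obtain ⟨C, hC, hle⟩ := hm.exists_green_le i
  exact ne_top_of_le_ne_top hC (hle k)

lemma IsModel.r_eq (hm : IsModel c b h) {k : ℕ} (hk : k ≠ 0) :
    r c b h k = ∑' i, ENNReal.ofReal (h i) * green c b k i := by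
  simp only [r, hm.mstar_eq hk]; rfl

lemma IsModel.r_ne_top (hm : IsModel c b h) {k : ℕ} (hk : k ≠ 0) : r c b h k ≠ ∞ := by
  rw [hm.r_eq hk]
  obtain ⟨k, rfl⟩ := Nat.exists_eq_succ_of_ne_zero hk
  obtain ⟨C, hC, hle⟩ := hm.exists_green_le k
  have h1 : ∑' i, ENNReal.ofReal (h i) * green c b (k + 1) i ≤ restartTotal h * C := by
    rw [← hm.tsum_restart, ← ENNReal.tsum_mul_right]
    gcongr with i
    exact hle i
  exact ne_top_of_le_ne_top (ENNReal.mul_ne_top ENNReal.ofReal_ne_top hC) h1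

end Finiteness

/-! ### Large catastrophe rates -/

section LargeRate

variable {c : ℕ} {b h : ℕ → ℝ}

lemma IsModel.catastropheBound_eq (hm : IsModel c b h) {β : ℝ} (hβ : 0 < β) :
    (1 + ENNReal.ofReal (b 0) / restartTotal h) / ENNReal.ofReal β =
      ENNReal.ofReal ((1 + b 0 / ∑' k, h k) / β) := by
  rw [restartTotal, ← ENNReal.ofReal_div_of_pos hm.h_pos, ← ENNReal.ofReal_one,
    ← ENNReal.ofReal_add zero_le_one (div_nonneg hm.b_zero_pos.le hm.h_pos.le),
    ← ENNReal.ofReal_div_of_pos hβ]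

lemma IsCatastropheTime.ne_top (hm : IsModel c b h) {β : ℝ} (hβ : 0 < β) {E : ℕ → ℝ≥0∞}
    (hE : IsCatastropheTime c b h β E) (j : ℕ) : E j ≠ ∞ := by
  cases j with
  | zero =>
    refine ne_top_of_le_ne_top ?_ hE.zero_le
    rw [hm.catastropheBound_eq hβ]
    exact ENNReal.add_ne_top.2 ⟨ENNReal.inv_ne_top.2 hm.restartTotal_ne_zero,
      ENNReal.ofReal_ne_top⟩
  | succ j =>
    refine ne_top_of_le_ne_top ?_ (hE.succ_le j)
    rw [hm.catastropheBound_eq hβ]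
    exact ENNReal.ofReal_ne_top

lemma IsCatastropheTime.le_toReal_zero (hm : IsModel c b h) {β : ℝ} (hβ : 0 < β) {E : ℕ → ℝ≥0∞}
    (hE : IsCatastropheTime c b h β E) : 1 / ∑' k, h k ≤ (E 0).toReal := by
  have h1 := hE.zero
  have h2 : 1 ≤ restartTotal h * E 0 := by rw [h1]; exact le_self_add
  have h3 := ENNReal.toReal_mono
    (ENNReal.mul_ne_top ENNReal.ofReal_ne_top (hE.ne_top hm hβ 0)) h2
  rw [ENNReal.toReal_mul, ENNReal.toReal_ofReal hm.h_pos.le, ENNReal.toReal_one] at h3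
  rw [div_le_iff₀ hm.h_pos]
  linarith

lemma IsCatastropheTime.toReal_zero_le (hm : IsModel c b h) {β : ℝ} (hβ : 0 < β) {E : ℕ → ℝ≥0∞}
    (hE : IsCatastropheTime c b h β E) :
    (E 0).toReal ≤ 1 / ∑' k, h k + (1 + b 0 / ∑' k, h k) / β := by
  have h1 := hE.zero_le
  have hp := hm.h_pos
  have hb := hm.b_zero_pos
  rw [hm.catastropheBound_eq hβ, restartTotal, ← ENNReal.ofReal_inv_of_pos hp,
    ← ENNReal.ofReal_add (by positivity) (by positivity)] at h1
  rw [one_div]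
  exact ENNReal.toReal_le_of_le_ofReal (by positivity) h1

lemma IsCatastropheTime.toReal_succ_le (hm : IsModel c b h) {β : ℝ} (hβ : 0 < β) {E : ℕ → ℝ≥0∞}
    (hE : IsCatastropheTime c b h β E) (j : ℕ) :
    (E (j + 1)).toReal ≤ (1 + b 0 / ∑' k, h k) / β := by
  have h1 := hE.succ_le j
  have hp := hm.h_pos
  have hb := hm.b_zero_pos
  rw [hm.catastropheBound_eq hβ] at h1
  exact ENNReal.toReal_le_of_le_ofReal (by positivity) h1

lemma toReal_killedRate_succ (hm : IsModel c b h) {β : ℝ} (hβ : 0 < β) (j : ℕ) :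
    (killedRate c b β (j + 1)).toReal = (killedRate c b 0 (j + 1)).toReal + β := by
  rw [killedRate_zero_left, killedRate, busy_succ, mul_one,
    ENNReal.toReal_add (hm.baseRate_ne_top _) ENNReal.ofReal_ne_top, ENNReal.toReal_ofReal hβ.le]

lemma tendsto_div_add_atTop (q κ : ℝ) :
    Tendsto (fun β : ℝ => β * (κ / (q + β))) atTop (𝓝 κ) := by
  have h1 : Tendsto (fun β : ℝ => κ - κ * q * (q + β)⁻¹) atTop (𝓝 (κ - κ * q * 0)) :=
    tendsto_const_nhds.sub ((tendsto_inv_atTop_zero.comp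
      (tendsto_atTop_add_const_left _ q tendsto_id)).const_mul _)
  rw [mul_zero, sub_zero] at h1
  refine h1.congr' ?_
  filter_upwards [eventually_gt_atTop (-q)] with β hβ
  have : q + β ≠ 0 := by linarith
  field_simp
  ring

lemma tendsto_catastropheTime_zero_atTop (hm : IsModel c b h) {E : ℝ → ℕ → ℝ≥0∞}
    (hE : ∀ β, 0 < β → IsCatastropheTime c b h β (E β)) :
    Tendsto (fun β => (E β 0).toReal) atTop (𝓝 (1 / ∑' k, h k)) := by
  have h1 : Tendsto (fun β : ℝ => 1 / ∑' k, h k + (1 + b 0 / ∑' k, h k) / β) atTop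
      (𝓝 (1 / ∑' k, h k + 0)) :=
    tendsto_const_nhds.add (tendsto_const_nhds.div_atTop tendsto_id)
  rw [add_zero] at h1
  refine tendsto_of_tendsto_of_tendsto_of_le_of_le' tendsto_const_nhds h1 ?_ ?_
  · filter_upwards [eventually_gt_atTop 0] with β hβ using (hE β hβ).le_toReal_zero hm hβ
  · filter_upwards [eventually_gt_atTop 0] with β hβ using (hE β hβ).toReal_zero_le hm hβ

/-- From state 1 the departure to 0 costs a further time of at least 1/h; keeping only that jump
gives a lower bound which matches the supersolution bound in the limit. -/
lemma tendsto_catastropheTime_one_atTop (hm : IsModel c b h) {E : ℝ → ℕ → ℝ≥0∞}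
    (hE : ∀ β, 0 < β → IsCatastropheTime c b h β (E β)) :
    Tendsto (fun β => β * (E β 1).toReal) atTop (𝓝 (1 + b 0 / ∑' k, h k)) := by
  refine tendsto_of_tendsto_of_tendsto_of_le_of_le'
    (tendsto_div_add_atTop (killedRate c b 0 1).toReal _) tendsto_const_nhds ?_ ?_
  · filter_upwards [eventually_gt_atTop 0] with β hβ
    gcongr
    have h1 := (hE β hβ).succ 0
    have h2 : 1 + ENNReal.ofReal (b 0) * E β 0 ≤ killedRate c b β 1 * E β 1 := by
      rw [h1, tsum_jump, zero_add, hm.downRate_one]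
      gcongr
      exact le_self_add
    have h3 := ENNReal.toReal_mono
      (ENNReal.mul_ne_top (hm.killedRate_ne_top _ _) ((hE β hβ).ne_top hm hβ 1)) h2
    rw [ENNReal.toReal_add ENNReal.one_ne_top
      (ENNReal.mul_ne_top ENNReal.ofReal_ne_top ((hE β hβ).ne_top hm hβ 0)), ENNReal.toReal_mul,
      ENNReal.toReal_mul, ENNReal.toReal_ofReal hm.b_zero_pos.le,
      toReal_killedRate_succ hm hβ 0, ENNReal.toReal_one] at h3
    have h4 := (hE β hβ).le_toReal_zero hm hβ
    rw [div_le_iff₀ (add_pos_of_nonneg_of_pos ENNReal.toReal_nonneg hβ)]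
    have h5 : b 0 / ∑' k, h k = b 0 * (1 / ∑' k, h k) := by ring
    have h6 := mul_le_mul_of_nonneg_left h4 hm.b_zero_pos.le
    rw [h5]
    linarith
  · filter_upwards [eventually_gt_atTop 0] with β hβ
    have := (hE β hβ).toReal_succ_le hm hβ 0
    rw [le_div_iff₀ hβ] at this
    linarith

/-- One jump from a state at least 2 cannot reach 0, and on the states `i ≥ 1` the expectation is
O(1/β); so all jumps are negligible against the killing. -/
lemma tendsto_catastropheTime_succ_atTop (hm : IsModel c b h) {E : ℝ → ℕ → ℝ≥0∞}
    (hE : ∀ β, 0 < β → IsCatastropheTime c b h β (E β)) (j : ℕ) :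
    Tendsto (fun β => β * (E β (j + 2)).toReal) atTop (𝓝 1) := by
  set q := (killedRate c b 0 (j + 2)).toReal with hq
  have hq0 : 0 ≤ q := ENNReal.toReal_nonneg
  have h1 : Tendsto (fun β : ℝ => 1 + q * ((1 + b 0 / ∑' k, h k) / β)) atTop
      (𝓝 (1 + q * 0)) :=
    tendsto_const_nhds.add ((tendsto_const_nhds.div_atTop tendsto_id).const_mul q)
  rw [mul_zero, add_zero] at h1
  refine tendsto_of_tendsto_of_tendsto_of_le_of_le' (tendsto_div_add_atTop q 1) h1 ?_ ?_
  · filter_upwards [eventually_gt_atTop 0] with β hβ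
    gcongr
    have h2 : 1 ≤ killedRate c b β (j + 2) * E β (j + 2) := by
      rw [(hE β hβ).succ (j + 1)]; exact le_self_add
    have h3 := ENNReal.toReal_mono
      (ENNReal.mul_ne_top (hm.killedRate_ne_top _ _) ((hE β hβ).ne_top hm hβ _)) h2
    rw [ENNReal.toReal_mul, toReal_killedRate_succ hm hβ (j + 1), ENNReal.toReal_one] at h3
    rw [div_le_iff₀ (add_pos_of_nonneg_of_pos ENNReal.toReal_nonneg hβ)]
    linarith
  · filter_upwards [eventually_gt_atTop 0] with β hβ
    have hb := hm.b_zero_pos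
    have hp := hm.h_pos
    have h2 : killedRate c b β (j + 2) * E β (j + 2) ≤
        1 + killedRate c b 0 (j + 2) * ENNReal.ofReal ((1 + b 0 / ∑' k, h k) / β) := by
      rw [(hE β hβ).succ (j + 1), killedRate_succ, ENNReal.ofReal_zero, add_zero,
        ← tsum_jump_const, tsum_jump, tsum_jump]
      gcongr with l
      · rw [← hm.catastropheBound_eq hβ]; exact (hE β hβ).succ_le j
      · rw [← hm.catastropheBound_eq hβ]; exact (hE β hβ).succ_le _
    have hne : killedRate c b 0 (j + 2) * ENNReal.ofReal ((1 + b 0 / ∑' k, h k) / β) ≠ ∞ :=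
      ENNReal.mul_ne_top (hm.killedRate_ne_top _ _) ENNReal.ofReal_ne_top
    have h3 := ENNReal.toReal_mono (ENNReal.add_ne_top.2 ⟨ENNReal.one_ne_top, hne⟩) h2
    rw [ENNReal.toReal_add ENNReal.one_ne_top hne, ENNReal.toReal_mul, ENNReal.toReal_mul,
      toReal_killedRate_succ hm hβ (j + 1), ENNReal.toReal_one,
      ENNReal.toReal_ofReal (by positivity)] at h3
    have h4 : 0 ≤ q * (E β (j + 2)).toReal := mul_nonneg hq0 ENNReal.toReal_nonneg
    have h5 : (q + β) * (E β (j + 2)).toReal = q * (E β (j + 2)).toReal +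
      β * (E β (j + 2)).toReal := by ring
    have h6 : (q + β) * (E β (j + 2)).toReal ≤ 1 + q * ((1 + b 0 / ∑' k, h k) / β) := h3
    linarith

end LargeRate

/-! ### A formula for the expected catastrophe times -/

section Formula

variable {c : ℕ} {b h : ℕ → ℝ}

/-- Rate of the restarts from `0` which return to `0` before the queue is killed. -/
noncomputable def restartEmpty (c : ℕ) (b h : ℕ → ℝ) (β : ℝ) : ℝ≥0∞ :=
  ∑' l, ENNReal.ofReal (h l) * emptyProb c b β l

/-- Expected busy time after a restart, multiplied by the restart rate. -/
noncomputable def restartBusy (c : ℕ) (b h : ℕ → ℝ) (β : ℝ) : ℝ≥0∞ :=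
  ∑' l, ENNReal.ofReal (h l) * busyTime c b β l

/-- Each excursion from 0 either returns or is killed; this is the h-average of
`IsModel.emptyProb_add_busyTime`. -/
lemma IsModel.restartEmpty_add (hm : IsModel c b h) {β : ℝ} (hβ : 0 < β) :
    restartEmpty c b h β + ENNReal.ofReal β * restartBusy c b h β = restartTotal h := by
  rw [restartEmpty, restartBusy, ← ENNReal.tsum_mul_left, ← ENNReal.tsum_add, ← hm.tsum_restart]
  congr 1; ext l
  calc _ = ENNReal.ofReal (h l) *
        (emptyProb c b β l + ENNReal.ofReal β * busyTime c b β l) := by ring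
    _ = _ := by rw [hm.emptyProb_add_busyTime hβ, mul_one]

lemma IsModel.restartEmpty_le (hm : IsModel c b h) (β : ℝ) :
    restartEmpty c b h β ≤ restartTotal h := by
  rw [restartEmpty, ← hm.tsum_restart]
  gcongr with l
  exact mul_le_of_le_one_right' (hm.emptyProb_le_one β l)

lemma IsModel.restartEmpty_ne_top (hm : IsModel c b h) (β : ℝ) : restartEmpty c b h β ≠ ∞ :=
  ne_top_of_le_ne_top ENNReal.ofReal_ne_top (hm.restartEmpty_le β)

lemma IsModel.exists_restart_pos (hm : IsModel c b h) : ∃ l, l ≠ 0 ∧ 0 < h l := by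
  by_contra! hcon
  have : ∀ l, h l = 0 := by
    intro l
    by_cases hl : l = 0
    · rw [hl, hm.h_zero]
    · exact le_antisymm (hcon l hl) (hm.h_nonneg l)
  have h1 := hm.h_pos
  simp [this] at h1

lemma IsModel.busyTime_ne_zero (hm : IsModel c b h) (β : ℝ) {l : ℕ} (hl : l ≠ 0) :
    busyTime c b β l ≠ 0 := by
  intro h0
  have h1 := mul_minSol (a := jump c b) (γ := busy) (hm.killedRate_ne_zero β)
    (hm.killedRate_ne_top β) l
  obtain ⟨l, rfl⟩ := Nat.exists_eq_succ_of_ne_zero hl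
  rw [show minSol (killedRate c b β) (jump c b) busy (l + 1) = 0 from h0, mul_zero] at h1
  have h2 := (add_eq_zero.1 h1.symm).1
  simp at h2

lemma IsModel.restartBusy_ne_zero (hm : IsModel c b h) (β : ℝ) : restartBusy c b h β ≠ 0 := by
  obtain ⟨l, hl, hpos⟩ := hm.exists_restart_pos
  intro h0
  rw [restartBusy, ENNReal.tsum_eq_zero] at h0
  have := h0 l
  rw [mul_eq_zero] at this
  rcases this with h1 | h1
  · rw [ENNReal.ofReal_eq_zero] at h1; linarith
  · exact hm.busyTime_ne_zero β hl h1

lemma IsModel.restartBusy_ne_top (hm : IsModel c b h) {β : ℝ} (hβ : 0 < β) :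
    restartBusy c b h β ≠ ∞ := by
  intro h0
  have h1 := hm.restartEmpty_add hβ
  rw [h0, ENNReal.mul_top (by simpa using hβ), add_top] at h1
  exact ENNReal.ofReal_ne_top h1.symm

/-- Decomposition of the catastrophe time at the time at which the queue empties. -/
lemma IsCatastropheTime.eq (hm : IsModel c b h) {β : ℝ} (hβ : 0 < β) {E : ℕ → ℝ≥0∞}
    (hE : IsCatastropheTime c b h β E) (j : ℕ) :
    E j = busyTime c b β j + E 0 * emptyProb c b β j := by
  set K := E 0 + (1 + ENNReal.ofReal (b 0) / restartTotal h) / ENNReal.ofReal β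
  have hK : K ≠ ∞ := by
    refine ENNReal.add_ne_top.2 ⟨hE.ne_top hm hβ 0, ?_⟩
    rw [hm.catastropheBound_eq hβ]
    exact ENNReal.ofReal_ne_top
  -- Prescribing the value `E 0` at the absorbing state makes `E` a bounded solution for a source
  -- that splits linearly.
  have h1 := hm.eq_minSol_of_bounded hβ (x := E)
    (γ := fun i => busy i + E 0 * (Pi.single 0 1 : ℕ → ℝ≥0∞) i) (fun i => ?_) hK (fun i => ?_) j
  · rw [h1, minSol_add, minSol_const_mul]; rfl
  · cases i with
    | zero => simp
    | succ i => simpa using hE.succ i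
  · cases i with
    | zero => exact le_self_add
    | succ i => exact (hE.succ_le i).trans le_add_self

lemma IsModel.emptyProb_ne_top (hm : IsModel c b h) (β : ℝ) (j : ℕ) : emptyProb c b β j ≠ ∞ :=
  ne_top_of_le_ne_top ENNReal.one_ne_top (hm.emptyProb_le_one β j)

/-- Insert the decomposition at the emptying time into the equation at 0 and solve the resulting
scalar renewal equation for `E 0`. This form suits the limit in which the mean busy time stays
finite. -/
lemma IsCatastropheTime.mul_toReal (hm : IsModel c b h) {β : ℝ} (hβ : 0 < β) {E : ℕ → ℝ≥0∞}
    (hE : IsCatastropheTime c b h β E) (j : ℕ) :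
    β * (E j).toReal = 1 + (emptyProb c b β j).toReal / (restartBusy c b h β).toReal := by
  have hβ0 : ENNReal.ofReal β ≠ 0 := by simpa using hβ
  have hE0 := hE.ne_top hm hβ 0
  have hT := hm.restartBusy_ne_top hβ
  have hTpos : 0 < (restartBusy c b h β).toReal :=
    ENNReal.toReal_pos (hm.restartBusy_ne_zero β) hT
  have h1 := congrArg ENNReal.toReal (hm.restartEmpty_add hβ)
  rw [ENNReal.toReal_add (hm.restartEmpty_ne_top β) (ENNReal.mul_ne_top ENNReal.ofReal_ne_top hT),
    ENNReal.toReal_mul, ENNReal.toReal_ofReal hβ.le] at h1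
  have h2 : restartTotal h * E 0 =
      1 + (restartBusy c b h β + E 0 * restartEmpty c b h β) := by
    rw [hE.zero, restartBusy, restartEmpty, ← ENNReal.tsum_mul_left, ← ENNReal.tsum_add]
    congr 2; ext l
    rw [hE.eq hm hβ l]; ring
  have h3 := congrArg ENNReal.toReal h2
  rw [ENNReal.toReal_add ENNReal.one_ne_top (ENNReal.add_ne_top.2
    ⟨hT, ENNReal.mul_ne_top hE0 (hm.restartEmpty_ne_top β)⟩),
    ENNReal.toReal_add hT (ENNReal.mul_ne_top hE0 (hm.restartEmpty_ne_top β)),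
    ENNReal.toReal_mul, ENNReal.toReal_mul, ENNReal.toReal_one] at h3
  have ht : busyTime c b β j ≠ ∞ := by
    intro h0
    have := hm.emptyProb_add_busyTime hβ j
    rw [h0, ENNReal.mul_top hβ0, add_top] at this
    exact ENNReal.one_ne_top this.symm
  have h4 := congrArg ENNReal.toReal (hm.emptyProb_add_busyTime hβ j)
  rw [ENNReal.toReal_add (hm.emptyProb_ne_top β j) (ENNReal.mul_ne_top ENNReal.ofReal_ne_top ht),
    ENNReal.toReal_mul, ENNReal.toReal_ofReal hβ.le, ENNReal.toReal_one] at h4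
  have h5 := congrArg ENNReal.toReal (hE.eq hm hβ j)
  rw [ENNReal.toReal_add ht (ENNReal.mul_ne_top hE0 (hm.emptyProb_ne_top β j)),
    ENNReal.toReal_mul] at h5
  set T := (restartBusy c b h β).toReal
  set F := (restartEmpty c b h β).toReal
  set e := (E 0).toReal
  set f := (emptyProb c b β j).toReal
  set t := (busyTime c b β j).toReal
  -- Here h = F + βT is substituted into h e = 1 + T + e F.
  have h6 : β * T * e = 1 + T := by
    have : (F + β * T) * e = 1 + (T + e * F) := by rw [h1]; exact h3
    linarith
  have h7 : β * e = 1 / T + 1 := by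
    field_simp
    linarith
  rw [h5, mul_add, show β * t = 1 - f by linarith, show β * (e * f) = β * e * f by ring, h7]
  ring

/-- The same identity with β T replaced by h - F, which stays positive as β ↓ 0 in the transient
case. -/
lemma IsCatastropheTime.toReal_sub (hm : IsModel c b h) {β : ℝ} (hβ : 0 < β) {E : ℕ → ℝ≥0∞}
    (hE : IsCatastropheTime c b h β E) (j : ℕ) :
    (E j).toReal - 1 / β = (emptyProb c b β j).toReal /
      ((restartTotal h).toReal - (restartEmpty c b h β).toReal) := by
  have h0 := hE.mul_toReal hm hβ j
  have hT := hm.restartBusy_ne_top hβ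
  have hTpos : 0 < (restartBusy c b h β).toReal :=
    ENNReal.toReal_pos (hm.restartBusy_ne_zero β) hT
  have h1 := congrArg ENNReal.toReal (hm.restartEmpty_add hβ)
  rw [ENNReal.toReal_add (hm.restartEmpty_ne_top β) (ENNReal.mul_ne_top ENNReal.ofReal_ne_top hT),
    ENNReal.toReal_mul, ENNReal.toReal_ofReal hβ.le] at h1
  rw [← h1, add_sub_cancel_left]
  have h2 : (E j).toReal =
      (1 + (emptyProb c b β j).toReal / (restartBusy c b h β).toReal) / β := by
    rw [← h0]; field_simp
  rw [h2]
  field_simp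
  ring

end Formula

/-! ### The transient case -/

section Transient

variable {c : ℕ} {b h : ℕ → ℝ}

lemma IsModel.b_add_two_nonneg (hm : IsModel c b h) (j : ℕ) : 0 ≤ b (j + 2) :=
  hm.b_nonneg _ (by omega)

lemma IsModel.summable_b_mul_pow (hm : IsModel c b h) {s : ℝ} (hs0 : 0 ≤ s) (hs1 : s ≤ 1) :
    Summable fun j => b (j + 2) * s ^ (j + 2) :=
  hm.hasSum_b_tail.summable.of_nonneg_of_le
    (fun j => mul_nonneg (hm.b_add_two_nonneg j) (pow_nonneg hs0 _))
    (fun j => mul_le_of_le_one_right (hm.b_add_two_nonneg j) (pow_le_one₀ hs0 hs1))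

lemma IsModel.Bi_eq (hm : IsModel c b h) {s : ℝ} (hs0 : 0 ≤ s) (hs1 : s ≤ 1) :
    Bi b c s = c * b 0 * (1 - s) - (-b 1 - b 0) * s + ∑' j, b (j + 2) * s ^ (j + 2) := by
  have h1 : Summable fun j => b j * s ^ j :=
    (summable_nat_add_iff 2).1 (hm.summable_b_mul_pow hs0 hs1)
  rw [Bi, B, ← h1.sum_add_tsum_nat_add 2]
  simp only [Finset.sum_range_succ, Finset.range_zero, Finset.sum_empty, pow_zero, pow_one]
  ring

lemma IsModel.Bi_one (hm : IsModel c b h) : Bi b c 1 = 0 := by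
  rw [hm.Bi_eq zero_le_one le_rfl]
  simp only [one_pow, mul_one, hm.hasSum_b_tail.tsum_eq]
  ring

lemma IsModel.continuousOn_Bi (hm : IsModel c b h) : ContinuousOn (Bi b c) (Set.Icc 0 1) := by
  have h1 : ContinuousOn (fun s : ℝ => c * b 0 * (1 - s) - (-b 1 - b 0) * s +
      ∑' j, b (j + 2) * s ^ (j + 2)) (Set.Icc 0 1) := by
    refine ContinuousOn.add (by fun_prop) ?_
    refine continuousOn_tsum (fun j => by fun_prop) hm.hasSum_b_tail.summable fun j s hs => ?_
    rw [Real.norm_of_nonneg (mul_nonneg (hm.b_add_two_nonneg j) (pow_nonneg hs.1 _))]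
    exact mul_le_of_le_one_right (hm.b_add_two_nonneg j) (pow_le_one₀ hs.1 hs.2)
  exact h1.congr fun s hs => hm.Bi_eq hs.1 hs.2

lemma IsModel.smallestRoot_mem (hm : IsModel c b h) :
    0 ≤ smallestRoot c b ∧ smallestRoot c b ≤ 1 ∧ Bi b c (smallestRoot c b) = 0 := by
  have h1 : {s | 0 ≤ s ∧ s ≤ 1 ∧ Bi b c s = 0} = Set.Icc 0 1 ∩ Bi b c ⁻¹' {0} := by
    ext s; simp [and_assoc]
  have h2 : IsClosed {s | 0 ≤ s ∧ s ≤ 1 ∧ Bi b c s = 0} := by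
    rw [h1]
    exact hm.continuousOn_Bi.preimage_isClosed_of_isClosed isClosed_Icc isClosed_singleton
  exact h2.csInf_mem ⟨1, zero_le_one, le_rfl, hm.Bi_one⟩ ⟨0, fun s hs => hs.1⟩

/-- Intermediate values: B_c(0) = c b₀ is nonnegative. -/
lemma IsModel.smallestRoot_le (hm : IsModel c b h) {s : ℝ} (hs0 : 0 ≤ s) (hs1 : s ≤ 1)
    (hs : Bi b c s ≤ 0) : smallestRoot c b ≤ s := by
  have h0 : 0 ≤ Bi b c 0 := by
    rw [hm.Bi_eq le_rfl zero_le_one]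
    simpa using mul_nonneg (Nat.cast_nonneg c) hm.b_zero_pos.le
  obtain ⟨t, ht, ht0⟩ := intermediate_value_Icc' hs0
    (hm.continuousOn_Bi.mono (Set.Icc_subset_Icc_right hs1)) ⟨hs, h0⟩
  have h1 : smallestRoot c b ≤ t :=
    csInf_le ⟨0, fun s hs => hs.1⟩ ⟨ht.1, ht.2.trans hs1, ht0⟩
  exact h1.trans ht.2

/-- A positive derivative at `1` makes `B_c` negative somewhere to the left of `1`. -/
lemma IsModel.exists_Bi_neg (hm : IsModel c b h) (hpos : 0 < BiDerivOne b c) :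
    ∃ s : ℝ, 0 < s ∧ s < 1 ∧ Bi b c s < 0 := by
  set v : ℝ := c * b 0 + (-b 1 - b 0) with hv
  have hv0 : 0 ≤ v := add_nonneg (mul_nonneg (Nat.cast_nonneg c) hm.b_zero_pos.le)
    hm.upTotal_nonneg
  have h1 : ENNReal.ofReal v < ∑' j : ℕ, ENNReal.ofReal (((j + 2 : ℕ) : ℝ) * b (j + 2)) := by
    by_contra hcon
    refine absurd hpos (not_lt.2 ?_)
    have h2 : ((∑' j : ℕ, ENNReal.ofReal (((j + 2 : ℕ) : ℝ) * b (j + 2)) : ℝ≥0∞) : EReal) ≤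
        ((ENNReal.ofReal v : ℝ≥0∞) : EReal) := EReal.coe_ennreal_le_coe_ennreal_iff.2
          (not_lt.1 hcon)
    rw [EReal.coe_ennreal_ofReal, max_eq_left hv0] at h2
    calc BiDerivOne b c ≤ ((b 1 - ((c : ℝ) - 1) * b 0 : ℝ) : EReal) + (v : EReal) := by
          rw [BiDerivOne]; gcongr
      _ = 0 := by
          rw [← EReal.coe_add, hv, ← EReal.coe_zero]
          congr 1; ring
  rw [ENNReal.tsum_eq_iSup_nat, lt_iSup_iff] at h1
  obtain ⟨N, hN⟩ := h1
  rw [← ENNReal.ofReal_sum_of_nonneg (fun j _ => mul_nonneg (Nat.cast_nonneg _)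
    (hm.b_add_two_nonneg j))] at hN
  have hN' := (ENNReal.ofReal_lt_ofReal_iff_of_nonneg hv0).1 hN
  -- By the geometric sum, B_c(s) ≤ (1 - s)(v - g(s)). Truncating at `N` keeps `g` continuous even
  -- when the derivative at 1 is infinite.
  set g : ℝ → ℝ := fun s =>
    ∑ j ∈ Finset.range N, b (j + 2) * ∑ m ∈ Finset.range (j + 2), s ^ m with hg
  have hgc : Continuous g := by fun_prop
  have hg1 : v < g 1 := by
    refine hN'.trans_eq (Finset.sum_congr rfl fun j _ => ?_)
    simp [mul_comm]
  have h2 : ∀ᶠ s in 𝓝[<] (1 : ℝ), v < g s :=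
    nhdsWithin_le_nhds (hgc.tendsto 1 |>.eventually (lt_mem_nhds hg1))
  have h3 : ∀ᶠ s in 𝓝[<] (1 : ℝ), s ∈ Set.Ioo (0 : ℝ) 1 := Ioo_mem_nhdsLT zero_lt_one
  obtain ⟨s, hs, hs01⟩ := (h2.and h3).exists
  refine ⟨s, hs01.1, hs01.2, ?_⟩
  have hsum := hm.summable_b_mul_pow hs01.1.le hs01.2.le
  have h4 : (1 - s) * g s ≤ (-b 1 - b 0) - ∑' j, b (j + 2) * s ^ (j + 2) := by
    have h5 := hm.hasSum_b_tail.sub hsum.hasSum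
    rw [← h5.tsum_eq]
    refine le_trans (le_of_eq ?_) (h5.summable.sum_le_tsum (Finset.range N) fun j _ => ?_)
    · rw [hg, Finset.mul_sum]
      refine Finset.sum_congr rfl fun j _ => ?_
      have := mul_neg_geom_sum s (j + 2)
      rw [mul_left_comm, this]; ring
    · have := mul_le_of_le_one_right (hm.b_add_two_nonneg j)
        (pow_le_one₀ hs01.1.le hs01.2.le : s ^ (j + 2) ≤ 1)
      linarith
  rw [hm.Bi_eq hs01.1.le hs01.2.le]
  have h6 : 0 < (1 - s) * (g s - v) := mul_pos (by linarith [hs01.2]) (by linarith)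
  have h7 : (1 - s) * v = c * b 0 * (1 - s) + (-b 1 - b 0) - (-b 1 - b 0) * s := by
    rw [hv]; ring
  nlinarith

/-- Source term in the equation for the function `i ↦ s ^ i`. -/
noncomputable def powSource (c : ℕ) (b : ℕ → ℝ) (s : ℝ) : ℕ → ℝ≥0∞
  | 0 => 1
  | i + 1 => ENNReal.ofReal
      (s ^ i * (((c : ℝ) - (min (i + 1) c : ℕ)) * b 0 * (1 - s) - Bi b c s))

/-- With all `c` servers busy the defect of s^(i+1) is -s^i B_c(s); idle servers add (c - min(i+1,
c)) b₀ (1 - s) s^i. The condition B_c(s) ≤ 0 keeps the source nonnegative, so `ENNReal.ofReal` loses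
nothing. -/
lemma IsModel.mul_pow_eq (hm : IsModel c b h) {s : ℝ} (hs0 : 0 ≤ s) (hs1 : s ≤ 1)
    (hs : Bi b c s ≤ 0) (i : ℕ) :
    killedRate c b 0 i * ENNReal.ofReal s ^ i =
      powSource c b s i + ∑' l, jump c b i l * ENNReal.ofReal s ^ l := by
  cases i with
  | zero => simp [powSource]
  | succ i =>
    have hsum := hm.summable_b_mul_pow hs0 hs1
    have hnn : ∀ j, 0 ≤ b (j + 2) * s ^ (j + 2) := fun j =>
      mul_nonneg (hm.b_add_two_nonneg j) (pow_nonneg hs0 _)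
    have hmin : ((min (i + 1) c : ℕ) : ℝ) ≤ c := by exact_mod_cast min_le_right _ _
    have hb := hm.b_zero_pos.le
    have h1 : ∑' j, upRate b j * ENNReal.ofReal s ^ (j + (i + 2)) =
        ENNReal.ofReal (s ^ i * ∑' j, b (j + 2) * s ^ (j + 2)) := by
      rw [ENNReal.ofReal_mul (pow_nonneg hs0 i), ENNReal.ofReal_tsum_of_nonneg hnn hsum,
        ← ENNReal.tsum_mul_left]
      congr 1; ext j
      rw [ENNReal.ofReal_mul (hm.b_add_two_nonneg j), ENNReal.ofReal_pow hs0,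
        ENNReal.ofReal_pow hs0, upRate]
      ring
    have hA : 0 ≤ s ^ i * (((c : ℝ) - (min (i + 1) c : ℕ)) * b 0 * (1 - s) - Bi b c s) := by
      refine mul_nonneg (pow_nonneg hs0 i) ?_
      have : 0 ≤ ((c : ℝ) - (min (i + 1) c : ℕ)) * b 0 * (1 - s) :=
        mul_nonneg (mul_nonneg (by linarith) hb) (by linarith)
      linarith
    have hd : 0 ≤ ((min (i + 1) c : ℕ) : ℝ) * b 0 := mul_nonneg (Nat.cast_nonneg _) hb
    rw [tsum_jump, h1, killedRate_succ, ENNReal.ofReal_zero, add_zero, hm.upTotal_eq, downRate,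
      ← ENNReal.ofReal_add hd hm.upTotal_nonneg, ← ENNReal.ofReal_pow hs0,
      ← ENNReal.ofReal_pow hs0, ← ENNReal.ofReal_mul (add_nonneg hd hm.upTotal_nonneg),
      ← ENNReal.ofReal_mul hd, powSource, ← ENNReal.ofReal_add (mul_nonneg hd (pow_nonneg hs0 i))
      (mul_nonneg (pow_nonneg hs0 i) (tsum_nonneg hnn)), ← ENNReal.ofReal_add hA
      (add_nonneg (mul_nonneg hd (pow_nonneg hs0 i))
      (mul_nonneg (pow_nonneg hs0 i) (tsum_nonneg hnn)))]
    congr 1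
    rw [hm.Bi_eq hs0 hs1]
    ring

lemma IsModel.minSol_powSource_le (hm : IsModel c b h) {s : ℝ} (hs0 : 0 ≤ s) (hs1 : s ≤ 1)
    (hs : Bi b c s ≤ 0) (i : ℕ) :
    minSol (killedRate c b 0) (jump c b) (powSource c b s) i ≤ ENNReal.ofReal s ^ i :=
  minSol_le (hm.killedRate_ne_zero 0) (hm.killedRate_ne_top 0)
    (fun i => (hm.mul_pow_eq hs0 hs1 hs i).ge) i

/-- In the transient case the function `i ↦ u ^ i` is a minimal solution. -/
lemma IsModel.smallestRoot_pow_eq (hm : IsModel c b h) (hpos : 0 < BiDerivOne b c) (i : ℕ) :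
    ENNReal.ofReal (smallestRoot c b) ^ i =
      minSol (killedRate c b 0) (jump c b) (powSource c b (smallestRoot c b)) i := by
  obtain ⟨hu0, hu1, hu⟩ := hm.smallestRoot_mem
  -- The powers of this `s` provide the domination needed for `le_minSol`: u^i ≤ s^i, and since
  -- -B_c(s) > 0 the source belonging to `s` is at least ε s^i.
  obtain ⟨s, hs0, hs1, hs⟩ := hm.exists_Bi_neg hpos
  have hus := hm.smallestRoot_le hs0.le hs1.le hs.le
  set ε := ENNReal.ofReal (-Bi b c s) with hε
  have hε0 : ε ≠ 0 := by simpa [hε] using hs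
  have hεt : ε ≠ ∞ := ENNReal.ofReal_ne_top
  -- An upper bound for the exit rates of the states `i ≥ 1`; including ε ensures ε / R ≤ 1, as
  -- needed at state 0.
  set R := ENNReal.ofReal (c * b 0) + upTotal b + ε with hR
  have hRt : R ≠ ∞ := ENNReal.add_ne_top.2
    ⟨ENNReal.add_ne_top.2 ⟨ENNReal.ofReal_ne_top, hm.upTotal_ne_top⟩, ENNReal.ofReal_ne_top⟩
  have hR0 : R ≠ 0 := fun h0 => hε0 (add_eq_zero.1 h0).2
  refine le_antisymm ?_ (hm.minSol_powSource_le hu0 hu1 hu.le i)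
  refine le_minSol (γ' := powSource c b s) (C := R / ε)
    (x := fun i => ENNReal.ofReal (smallestRoot c b) ^ i)
    (hm.killedRate_ne_zero 0) (hm.killedRate_ne_top 0)
    (fun i => (hm.mul_pow_eq hu0 hu1 hu.le i).le) (ENNReal.div_lt_top hRt hε0).ne
    (fun i => ?_) i ?_
  · have h1 : ε / R * ENNReal.ofReal s ^ i ≤
        minSol (killedRate c b 0) (jump c b) (powSource c b s) i := by
      rw [minSol_eq_step]
      refine le_trans ?_ le_self_add
      cases i with
      | zero =>
        simp only [powSource, killedRate_zero, pow_zero, mul_one, div_one]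
        exact ENNReal.div_le_of_le_mul (by rw [one_mul]; exact le_add_self)
      | succ i =>
        have hmin : ((min (i + 1) c : ℕ) : ℝ) ≤ c := by exact_mod_cast min_le_right _ _
        have h2 : ε * ENNReal.ofReal s ^ (i + 1) ≤ powSource c b s (i + 1) := by
          rw [powSource, hε, ← ENNReal.ofReal_pow hs0.le, ← ENNReal.ofReal_mul (by linarith)]
          refine ENNReal.ofReal_le_ofReal ?_
          have h3 : 0 ≤ ((c : ℝ) - (min (i + 1) c : ℕ)) * b 0 * (1 - s) :=
            mul_nonneg (mul_nonneg (by linarith) hm.b_zero_pos.le) (by linarith)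
          have h4 : s ^ (i + 1) ≤ s ^ i := pow_le_pow_of_le_one hs0.le hs1.le (Nat.le_succ i)
          have h5 : 0 ≤ s ^ i := pow_nonneg hs0.le i
          calc -Bi b c s * s ^ (i + 1) ≤ -Bi b c s * s ^ i := by gcongr; linarith
            _ ≤ _ := by nlinarith
        have h6 : killedRate c b 0 (i + 1) ≤ R := by
          rw [killedRate_succ, ENNReal.ofReal_zero, add_zero]
          refine le_trans ?_ le_self_add
          gcongr
          exact hm.downRate_le _
        calc ε / R * ENNReal.ofReal s ^ (i + 1) = ε * ENNReal.ofReal s ^ (i + 1) / R := by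
              simp only [div_eq_mul_inv]; ring
          _ ≤ _ := by gcongr
    calc ENNReal.ofReal (smallestRoot c b) ^ i ≤ 1 * ENNReal.ofReal s ^ i := by
          rw [one_mul]; gcongr
      _ = R / ε * (ε / R) * ENNReal.ofReal s ^ i := by
          rw [← ENNReal.inv_div (Or.inr hεt) (Or.inr hε0), ENNReal.inv_mul_cancel
            (ENNReal.div_ne_zero.2 ⟨hε0, hRt⟩) (ENNReal.div_lt_top hεt hR0).ne]
      _ ≤ _ := by rw [mul_assoc]; gcongr
  · refine ne_top_of_le_ne_top ?_ (hm.minSol_powSource_le hs0.le hs1.le hs.le i)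
    exact ENNReal.pow_ne_top ENNReal.ofReal_ne_top

lemma tsum_nat_eq_zero_add_sum {c : ℕ} (hc : 1 ≤ c) {f : ℕ → ℝ≥0∞} (hf : ∀ k, c ≤ k → f k = 0) :
    ∑' k, f k = f 0 + ∑ k ∈ Finset.Ico 1 c, f k := by
  rw [tsum_eq_sum (s := Finset.range c) fun k hk => hf k (by simpa using hk),
    Finset.range_eq_Ico, Finset.sum_eq_sum_Ico_succ_bot (by omega)]

/-- Since B_c(u) = 0, only states with idle servers and state 0 carry a source; expand over point
sources. -/
lemma IsModel.smallestRoot_pow_eq_add (hm : IsModel c b h) (hpos : 0 < BiDerivOne b c) (i : ℕ) :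
    ENNReal.ofReal (smallestRoot c b) ^ i = emptyProb c b 0 i +
      ∑ k ∈ Finset.Ico 1 c, ENNReal.ofReal (smallestRoot c b ^ (k - 1) * ((c : ℝ) - k) * b 0 *
        (1 - smallestRoot c b)) * green c b k i := by
  obtain ⟨hu0, hu1, hu⟩ := hm.smallestRoot_mem
  rw [hm.smallestRoot_pow_eq hpos, minSol_eq_tsum_single,
    tsum_nat_eq_zero_add_sum hm.one_le_c]
  · congr 1
    · simp [powSource, emptyProb]
    · refine Finset.sum_congr rfl fun k hk => ?_
      rw [Finset.mem_Ico] at hk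
      obtain ⟨k, rfl⟩ := Nat.exists_eq_succ_of_ne_zero (by omega : k ≠ 0)
      rw [powSource, hu, min_eq_left (by omega : k + 1 ≤ c), green]
      congr 2
      simp only [Nat.succ_eq_add_one, Nat.add_sub_cancel]
      ring
  · rintro (_ | k) hk
    · exact absurd hm.one_le_c (by omega)
    · rw [powSource, hu, min_eq_right hk]
      simp

lemma IsModel.summable_h_mul_pow (hm : IsModel c b h) {s : ℝ} (hs0 : 0 ≤ s) (hs1 : s ≤ 1) :
    Summable fun j => h j * s ^ j :=
  hm.h_summable.of_nonneg_of_le (fun j => mul_nonneg (hm.h_nonneg j) (pow_nonneg hs0 _))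
    (fun j => mul_le_of_le_one_right (hm.h_nonneg j) (pow_le_one₀ hs0 hs1))

lemma IsModel.ofReal_H_eq (hm : IsModel c b h) (hpos : 0 < BiDerivOne b c) :
    ENNReal.ofReal (H h (smallestRoot c b)) = restartEmpty c b h 0 +
      ∑ k ∈ Finset.Ico 1 c, ENNReal.ofReal (smallestRoot c b ^ (k - 1) * ((c : ℝ) - k) * b 0 *
        (1 - smallestRoot c b)) * r c b h k := by
  obtain ⟨hu0, hu1, hu⟩ := hm.smallestRoot_mem
  rw [H, ENNReal.ofReal_tsum_of_nonneg
    (fun j => mul_nonneg (hm.h_nonneg j) (pow_nonneg hu0 _)) (hm.summable_h_mul_pow hu0 hu1)]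
  have h1 : ∀ j, ENNReal.ofReal (h j * smallestRoot c b ^ j) =
      ENNReal.ofReal (h j) * emptyProb c b 0 j + ∑ k ∈ Finset.Ico 1 c,
        ENNReal.ofReal (smallestRoot c b ^ (k - 1) * ((c : ℝ) - k) * b 0 *
        (1 - smallestRoot c b)) * (ENNReal.ofReal (h j) * green c b k j) := by
    intro j
    rw [ENNReal.ofReal_mul (hm.h_nonneg j), ENNReal.ofReal_pow hu0,
      hm.smallestRoot_pow_eq_add hpos, mul_add, Finset.mul_sum]
    congr 1
    refine Finset.sum_congr rfl fun k _ => ?_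
    ring
  simp only [h1]
  rw [ENNReal.tsum_add, restartEmpty, Summable.tsum_finsetSum fun k _ => ENNReal.summable]
  congr 1
  refine Finset.sum_congr rfl fun k hk => ?_
  rw [Finset.mem_Ico] at hk
  rw [ENNReal.tsum_mul_left, hm.r_eq (by omega)]

/-- Interprets the denominator: the rate of restarts after which the unkilled queue never empties.
-/
lemma IsModel.transientDenom_eq (hm : IsModel c b h) (hpos : 0 < BiDerivOne b c) :
    transientDenom c b h = (restartTotal h).toReal - (restartEmpty c b h 0).toReal := by
  obtain ⟨hu0, hu1, hu⟩ := hm.smallestRoot_mem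
  have hnn : ∀ k ∈ Finset.Ico 1 c,
      0 ≤ smallestRoot c b ^ (k - 1) * ((c : ℝ) - k) * b 0 * (1 - smallestRoot c b) := by
    intro k hk
    rw [Finset.mem_Ico] at hk
    have h1 : (k : ℝ) ≤ c := by exact_mod_cast hk.2.le
    have h2 := hm.b_zero_pos
    have h3 : 0 ≤ (c : ℝ) - k := by linarith
    have h4 : 0 ≤ 1 - smallestRoot c b := by linarith
    positivity
  have hfin : ∀ k ∈ Finset.Ico 1 c, ENNReal.ofReal (smallestRoot c b ^ (k - 1) * ((c : ℝ) - k) *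
      b 0 * (1 - smallestRoot c b)) * r c b h k ≠ ∞ := by
    intro k hk
    rw [Finset.mem_Ico] at hk
    exact ENNReal.mul_ne_top ENNReal.ofReal_ne_top (hm.r_ne_top (by omega))
  have hH : 0 ≤ H h (smallestRoot c b) :=
    tsum_nonneg fun j => mul_nonneg (hm.h_nonneg j) (pow_nonneg hu0 _)
  have h1 := congrArg ENNReal.toReal (hm.ofReal_H_eq hpos)
  rw [ENNReal.toReal_add (hm.restartEmpty_ne_top 0) (ENNReal.sum_ne_top.2 hfin),
    ENNReal.toReal_sum hfin, ENNReal.toReal_ofReal hH] at h1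
  rw [transientDenom, h1, restartTotal, ENNReal.toReal_ofReal hm.h_pos.le]
  have h2 : ∑ k ∈ Finset.Ico 1 c, (ENNReal.ofReal (smallestRoot c b ^ (k - 1) * ((c : ℝ) - k) *
      b 0 * (1 - smallestRoot c b)) * r c b h k).toReal =
      ∑ k ∈ Finset.Ico 1 c, smallestRoot c b ^ (k - 1) * ((c : ℝ) - k) * b 0 *
        (1 - smallestRoot c b) * (r c b h k).toReal := by
    refine Finset.sum_congr rfl fun k hk => ?_
    rw [ENNReal.toReal_mul, ENNReal.toReal_ofReal (hnn k hk)]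
  rw [h2]
  ring

/-- A point of (0, 1) where B_c is negative forces u < 1, hence H(u) < h. -/
lemma IsModel.transientDenom_pos (hm : IsModel c b h) (hpos : 0 < BiDerivOne b c) :
    0 < transientDenom c b h := by
  obtain ⟨hu0, hu1, hu⟩ := hm.smallestRoot_mem
  obtain ⟨s, hs0, hs1, hs⟩ := hm.exists_Bi_neg hpos
  have hus := (hm.smallestRoot_le hs0.le hs1.le hs.le).trans_lt hs1
  have h1 : H h (smallestRoot c b) < ∑' j, h j := by
    obtain ⟨l, hl, hpos⟩ := hm.exists_restart_pos
    refine Summable.tsum_lt_tsum (i := l)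
      (fun j => mul_le_of_le_one_right (hm.h_nonneg j) (pow_le_one₀ hu0 hu1)) ?_
      (hm.summable_h_mul_pow hu0 hu1) hm.h_summable
    exact mul_lt_of_lt_one_right hpos (pow_lt_one₀ hu0 hus hl)
  have h2 : 0 ≤ ∑ k ∈ Finset.Ico 1 c, smallestRoot c b ^ (k - 1) * ((c : ℝ) - k) * b 0 *
        (1 - smallestRoot c b) * (r c b h k).toReal := by
    refine Finset.sum_nonneg fun k hk => ?_
    rw [Finset.mem_Ico] at hk
    have h1 : (k : ℝ) ≤ c := by exact_mod_cast hk.2.le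
    have h2 := hm.b_zero_pos
    have h3 : 0 ≤ (c : ℝ) - k := by linarith
    have h4 : 0 ≤ 1 - smallestRoot c b := by linarith
    positivity
  rw [transientDenom]
  linarith

lemma IsModel.tendsto_emptyProb (hm : IsModel c b h) (j : ℕ) :
    Tendsto (fun β => (emptyProb c b β j).toReal) (𝓝[>] 0) (𝓝 (emptyProb c b 0 j).toReal) :=
  (ENNReal.tendsto_toReal (hm.emptyProb_ne_top 0 j)).comp (hm.tendsto_minSol_killedRate _ j)

lemma IsModel.tendsto_catastropheTime_transient (hm : IsModel c b h) (hpos : 0 < BiDerivOne b c)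
    {E : ℝ → ℕ → ℝ≥0∞} (hE : ∀ β, 0 < β → IsCatastropheTime c b h β (E β)) (j : ℕ) :
    Tendsto (fun β => (E β j).toReal - 1 / β) (𝓝[>] 0)
      (𝓝 ((emptyProb c b 0 j).toReal / transientDenom c b h)) := by
  have h1 : Tendsto (fun β => (restartEmpty c b h β).toReal) (𝓝[>] 0)
      (𝓝 (restartEmpty c b h 0).toReal) :=
    (ENNReal.tendsto_toReal (hm.restartEmpty_ne_top 0)).comp
      (hm.tendsto_tsum_minSol_killedRate _ fun _ => ENNReal.ofReal_ne_top)
  have h2 := (hm.tendsto_emptyProb j).div (tendsto_const_nhds.sub h1)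
    (by rw [← hm.transientDenom_eq hpos]; exact (hm.transientDenom_pos hpos).ne')
  rw [← hm.transientDenom_eq hpos] at h2
  refine h2.congr' ?_
  filter_upwards [self_mem_nhdsWithin] with β hβ
  exact ((hE β hβ).toReal_sub hm hβ j).symm

end Transient

/-! ### The positive recurrent case -/

section Recurrent

variable {c : ℕ} {b h : ℕ → ℝ}

/-- Rate at which idle servers would work in state `i`. -/
noncomputable def idleRate (c : ℕ) (b : ℕ → ℝ) (i : ℕ) : ℝ≥0∞ :=
  ENNReal.ofReal (((c : ℝ) - i) * b 0)

lemma IsModel.downRate_add_idleRate (hm : IsModel c b h) (i : ℕ) :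
    downRate c b i + idleRate c b i = ENNReal.ofReal (c * b 0) := by
  have hb := hm.b_zero_pos.le
  rcases le_total i c with hi | hi
  · have h1 : (i : ℝ) ≤ c := by exact_mod_cast hi
    rw [downRate, idleRate, min_eq_left hi, ← ENNReal.ofReal_add (by positivity)
      (mul_nonneg (by linarith) hb)]
    congr 1; ring
  · have h1 : (c : ℝ) ≤ i := by exact_mod_cast hi
    rw [downRate, idleRate, min_eq_right hi, show ENNReal.ofReal (((c : ℝ) - i) * b 0) = 0
      from ENNReal.ofReal_of_nonpos (mul_nonpos_of_nonpos_of_nonneg (by linarith) hb), add_zero]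

lemma idleRate_eq_zero (hm : IsModel c b h) {i : ℕ} (hi : c ≤ i) : idleRate c b i = 0 := by
  have h1 : (c : ℝ) ≤ i := by exact_mod_cast hi
  exact ENNReal.ofReal_of_nonpos
    (mul_nonpos_of_nonpos_of_nonneg (by linarith) hm.b_zero_pos.le)

/-- Negative drift in the form of an identity between rates. -/
lemma IsModel.drift_eq (hm : IsModel c b h) (hneg : BiDerivOne b c < 0) :
    0 < -(BiDerivOne b c).toReal ∧
      ENNReal.ofReal (-(BiDerivOne b c).toReal) + ∑' j : ℕ, upRate b j * ((j : ℝ≥0∞) + 1) =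
        ENNReal.ofReal (c * b 0) := by
  set S2 : ℝ≥0∞ := ∑' j : ℕ, ENNReal.ofReal (((j + 2 : ℕ) : ℝ) * b (j + 2)) with hS2
  have htop : S2 ≠ ∞ := by
    intro h0
    rw [BiDerivOne, ← hS2, h0, EReal.coe_ennreal_top, EReal.coe_add_top] at hneg
    exact not_top_lt hneg
  have h1 : BiDerivOne b c = ((b 1 - ((c : ℝ) - 1) * b 0 + S2.toReal : ℝ) : EReal) := by
    rw [BiDerivOne, ← hS2, EReal.coe_add, EReal.coe_ennreal_toReal htop]
  have h2 : (BiDerivOne b c).toReal = b 1 - ((c : ℝ) - 1) * b 0 + S2.toReal := by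
    rw [h1, EReal.toReal_coe]
  have h3 : 0 < -(BiDerivOne b c).toReal := by
    rw [h1, ← EReal.coe_zero, EReal.coe_lt_coe_iff] at hneg
    rw [h2]; linarith
  refine ⟨h3, ?_⟩
  -- The exponent `j + 2` belongs to a batch of size `j + 1`; the excess is one total arrival rate,
  -- cancelled at the end.
  have h4 : S2 = ∑' j : ℕ, upRate b j * ((j : ℝ≥0∞) + 1) + upTotal b := by
    rw [upTotal, ← ENNReal.tsum_add, hS2]
    congr 1; ext j
    rw [ENNReal.ofReal_mul (Nat.cast_nonneg _), ENNReal.ofReal_natCast, upRate]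
    push_cast
    ring
  have h5 : ENNReal.ofReal (-(BiDerivOne b c).toReal) + S2 =
      ENNReal.ofReal (c * b 0) + upTotal b := by
    rw [← ENNReal.ofReal_toReal htop, ← ENNReal.ofReal_add h3.le ENNReal.toReal_nonneg,
      hm.upTotal_eq, ← ENNReal.ofReal_add
      (mul_nonneg (Nat.cast_nonneg c) hm.b_zero_pos.le) hm.upTotal_nonneg, h2]
    congr 1; ring
  rw [h4, ← add_assoc] at h5
  exact (ENNReal.add_left_inj hm.upTotal_ne_top).1 h5

/-- The drift is -α plus the idle capacity. The idle term stands on the left to avoid subtraction in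
`ℝ≥0∞`. -/
lemma IsModel.mul_natCast_eq (hm : IsModel c b h) {α : ℝ≥0∞}
    (hα : α + ∑' j : ℕ, upRate b j * ((j : ℝ≥0∞) + 1) = ENNReal.ofReal (c * b 0)) (i : ℕ) :
    killedRate c b 0 i * (i : ℝ≥0∞) + idleRate c b i * busy i =
      α * busy i + ∑' l, jump c b i l * (l : ℝ≥0∞) := by
  cases i with
  | zero => simp
  | succ i =>
    have h1 : ∑' j, upRate b j * ((j + (i + 2) : ℕ) : ℝ≥0∞) =
        ∑' j : ℕ, upRate b j * ((j : ℝ≥0∞) + 1) + upTotal b * ((i : ℝ≥0∞) + 1) := by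
      rw [upTotal, ← ENNReal.tsum_mul_right, ← ENNReal.tsum_add]
      congr 1; ext j
      push_cast
      ring
    rw [tsum_jump, h1, killedRate_succ, ENNReal.ofReal_zero, add_zero, busy_succ, mul_one, mul_one]
    calc (downRate c b (i + 1) + upTotal b) * ((i + 1 : ℕ) : ℝ≥0∞) + idleRate c b (i + 1)
        = (downRate c b (i + 1) + idleRate c b (i + 1)) + (downRate c b (i + 1) * i +
          upTotal b * ((i : ℝ≥0∞) + 1)) := by push_cast; ring
      _ = _ := by rw [hm.downRate_add_idleRate, ← hα]; ring

/-- The queue needs at least `i` jumps to become empty from state `i`. -/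
lemma IsModel.le_neumannTerm (hm : IsModel c b h) {n i : ℕ} (hni : n < i) :
    (ENNReal.ofReal (c * b 0) + upTotal b)⁻¹ ≤
      neumannTerm (killedRate c b 0) (jump c b) busy n i := by
  have hle : ∀ i, killedRate c b 0 (i + 1) ≤ ENNReal.ofReal (c * b 0) + upTotal b := by
    intro i
    rw [killedRate_succ, ENNReal.ofReal_zero, add_zero]
    gcongr
    exact hm.downRate_le _
  induction n generalizing i with
  | zero =>
    obtain ⟨i, rfl⟩ := Nat.exists_eq_succ_of_ne_zero hni.ne'
    simp only [neumannTerm, Nat.succ_eq_add_one, busy_succ, one_div]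
    exact ENNReal.inv_le_inv.2 (hle i)
  | succ n ih =>
    obtain ⟨i, rfl⟩ := Nat.exists_eq_succ_of_ne_zero (Nat.ne_zero_of_lt hni)
    rw [neumannTerm, step, Nat.succ_eq_add_one, tsum_jump,
      ENNReal.le_div_iff_mul_le (Or.inl (hm.killedRate_ne_zero 0 _))
        (Or.inl (hm.killedRate_ne_top 0 _)), killedRate_succ, ENNReal.ofReal_zero, add_zero,
      mul_add, mul_comm, mul_comm _ (upTotal b), upTotal, ← ENNReal.tsum_mul_right]
    gcongr with j
    · exact ih (by omega)
    · exact ih (by omega)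

/-- At least `i` jumps occur before emptying, each preceded by a mean holding time of at least 1/R.
This supplies the domination required by `le_minSol`. -/
lemma IsModel.natCast_le_mul_busyTime (hm : IsModel c b h) (i : ℕ) :
    (i : ℝ≥0∞) ≤ (ENNReal.ofReal (c * b 0) + upTotal b) * busyTime c b 0 i := by
  set R := ENNReal.ofReal (c * b 0) + upTotal b with hR
  have hRt : R ≠ ∞ := ENNReal.add_ne_top.2 ⟨ENNReal.ofReal_ne_top, hm.upTotal_ne_top⟩
  have hR0 : R ≠ 0 := by
    intro h0
    have h1 := (add_eq_zero.1 h0).1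
    have h2 := hm.downRate_le 1
    rw [h1, hm.downRate_one] at h2
    exact hm.ofReal_b_zero_ne_zero (le_antisymm h2 zero_le)
  have h1 : ∑ n ∈ Finset.range i, R⁻¹ ≤ busyTime c b 0 i := by
    refine le_trans (Finset.sum_le_sum fun n hn => ?_) (ENNReal.sum_le_tsum (Finset.range i))
    exact hm.le_neumannTerm (Finset.mem_range.1 hn)
  rw [Finset.sum_const, Finset.card_range, nsmul_eq_mul] at h1
  calc (i : ℝ≥0∞) = R * (i * R⁻¹) := by
        rw [mul_left_comm, ENNReal.mul_inv_cancel hR0 hRt, mul_one]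
    _ ≤ _ := by gcongr

lemma IsModel.minSol_idleRate_eq (hm : IsModel c b h) (i : ℕ) :
    minSol (killedRate c b 0) (jump c b) (fun k => idleRate c b k * busy k) i =
      ∑ k ∈ Finset.Ico 1 c, idleRate c b k * green c b k i := by
  rw [minSol_eq_tsum_single, tsum_nat_eq_zero_add_sum hm.one_le_c]
  · rw [busy_zero, mul_zero, zero_mul, zero_add]
    refine Finset.sum_congr rfl fun k hk => ?_
    rw [Finset.mem_Ico] at hk
    obtain ⟨k, rfl⟩ := Nat.exists_eq_succ_of_ne_zero (by omega : k ≠ 0)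
    rw [Nat.succ_eq_add_one, busy_succ, mul_one, green]
  · intro k hk
    rw [idleRate_eq_zero hm hk, zero_mul, zero_mul]

lemma IsModel.sum_idleRate_mul_green_ne_top (hm : IsModel c b h) (i : ℕ) :
    ∑ k ∈ Finset.Ico 1 c, idleRate c b k * green c b k i ≠ ∞ := by
  refine ENNReal.sum_ne_top.2 fun k hk => ?_
  rw [Finset.mem_Ico] at hk
  exact ENNReal.mul_ne_top ENNReal.ofReal_ne_top (hm.green_ne_top (by omega) i)

/-- Adding the solution with idle-capacity source to i ↦ i compensates the idle servers and yields
an exact solution with constant source α on the busy states. -/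
lemma IsModel.busyTime_le (hm : IsModel c b h) {α : ℝ≥0∞}
    (hα : α + ∑' j : ℕ, upRate b j * ((j : ℝ≥0∞) + 1) = ENNReal.ofReal (c * b 0)) (i : ℕ) :
    α * busyTime c b 0 i ≤
      (i : ℝ≥0∞) + minSol (killedRate c b 0) (jump c b) (fun k => idleRate c b k * busy k) i := by
  have hd0 := hm.killedRate_ne_zero 0
  have hd := hm.killedRate_ne_top 0
  rw [busyTime, ← minSol_const_mul]
  refine minSol_le (x := fun i : ℕ => (i : ℝ≥0∞) +
    minSol (killedRate c b 0) (jump c b) (fun k => idleRate c b k * busy k) i) hd0 hd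
    (fun i => le_of_eq ?_) i
  simp only [mul_add, ENNReal.tsum_add]
  rw [mul_minSol hd0 hd, ← add_assoc, ← add_assoc, hm.mul_natCast_eq hα]

lemma IsModel.busyTime_ne_top (hm : IsModel c b h) {α : ℝ≥0∞} (hα0 : α ≠ 0)
    (hα : α + ∑' j : ℕ, upRate b j * ((j : ℝ≥0∞) + 1) = ENNReal.ofReal (c * b 0)) (i : ℕ) :
    busyTime c b 0 i ≠ ∞ := by
  intro h0
  have h1 := hm.busyTime_le hα i
  rw [h0, ENNReal.mul_top hα0, hm.minSol_idleRate_eq, top_le_iff] at h1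
  exact ENNReal.add_ne_top.2 ⟨ENNReal.natCast_ne_top i, hm.sum_idleRate_mul_green_ne_top i⟩ h1

/-- Mean busy times in terms of the Green function. -/
lemma IsModel.mul_busyTime_eq (hm : IsModel c b h) {α : ℝ≥0∞} (hα0 : α ≠ 0)
    (hα : α + ∑' j : ℕ, upRate b j * ((j : ℝ≥0∞) + 1) = ENNReal.ofReal (c * b 0)) (i : ℕ) :
    α * busyTime c b 0 i = i + ∑ k ∈ Finset.Ico 1 c, idleRate c b k * green c b k i := by
  have hd0 := hm.killedRate_ne_zero 0
  have hd := hm.killedRate_ne_top 0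
  rw [← hm.minSol_idleRate_eq]
  refine le_antisymm (hm.busyTime_le hα i) ?_
  rw [busyTime, ← minSol_const_mul]
  -- The same exact solution is now used as a subsolution. Both of its parts are dominated by the
  -- finite mean busy time: `i` through the jump count, the idle part because the idle rate is at
  -- most c b₀.
  refine le_minSol (γ' := busy) (x := fun i : ℕ => (i : ℝ≥0∞) +
    minSol (killedRate c b 0) (jump c b) (fun k => idleRate c b k * busy k) i)
    (C := (ENNReal.ofReal (c * b 0) + upTotal b) + ENNReal.ofReal (c * b 0)) hd0 hd
    (fun i => le_of_eq ?_) ?_ (fun i => ?_) i (hm.busyTime_ne_top hα0 hα i)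
  · simp only [mul_add, ENNReal.tsum_add]
    rw [mul_minSol hd0 hd, ← add_assoc, ← add_assoc, hm.mul_natCast_eq hα]
  · exact ENNReal.add_ne_top.2 ⟨ENNReal.add_ne_top.2
      ⟨ENNReal.ofReal_ne_top, hm.upTotal_ne_top⟩, ENNReal.ofReal_ne_top⟩
  · rw [add_mul]
    refine add_le_add (hm.natCast_le_mul_busyTime i) ?_
    rw [← minSol_const_mul]
    refine minSol_mono (fun k => ?_) hd0 hd i
    gcongr
    rw [← hm.downRate_add_idleRate k]
    exact le_add_self

lemma IsModel.mul_restartBusy_eq (hm : IsModel c b h) {α : ℝ≥0∞} (hα0 : α ≠ 0)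
    (hα : α + ∑' j : ℕ, upRate b j * ((j : ℝ≥0∞) + 1) = ENNReal.ofReal (c * b 0)) :
    α * restartBusy c b h 0 =
      mu1 h + ∑ k ∈ Finset.Ico 1 c, idleRate c b k * r c b h k := by
  have h1 : ∀ l, α * (ENNReal.ofReal (h l) * busyTime c b 0 l) = ENNReal.ofReal (l * h l) +
      ∑ k ∈ Finset.Ico 1 c, idleRate c b k * (ENNReal.ofReal (h l) * green c b k l) := by
    intro l
    rw [mul_left_comm, hm.mul_busyTime_eq hα0 hα, mul_add, Finset.mul_sum,
      ENNReal.ofReal_mul (Nat.cast_nonneg l), ENNReal.ofReal_natCast, mul_comm (l : ℝ≥0∞)]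
    congr 1
    refine Finset.sum_congr rfl fun k _ => ?_
    ring
  rw [restartBusy, ← ENNReal.tsum_mul_left]
  simp only [h1]
  rw [ENNReal.tsum_add, mu1, Summable.tsum_finsetSum fun k _ => ENNReal.summable]
  congr 1
  refine Finset.sum_congr rfl fun k hk => ?_
  rw [Finset.mem_Ico] at hk
  rw [ENNReal.tsum_mul_left, hm.r_eq (by omega)]

lemma IsModel.sum_idleRate_mul_r_ne_top (hm : IsModel c b h) :
    ∑ k ∈ Finset.Ico 1 c, idleRate c b k * r c b h k ≠ ∞ := by
  refine ENNReal.sum_ne_top.2 fun k hk => ?_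
  rw [Finset.mem_Ico] at hk
  exact ENNReal.mul_ne_top ENNReal.ofReal_ne_top (hm.r_ne_top (by omega))

lemma IsModel.toReal_sum_idleRate (hm : IsModel c b h) :
    (∑ k ∈ Finset.Ico 1 c, idleRate c b k * r c b h k).toReal = rSum c b h := by
  rw [ENNReal.toReal_sum, rSum]
  · refine Finset.sum_congr rfl fun k hk => ?_
    rw [Finset.mem_Ico] at hk
    have h1 : (k : ℝ) ≤ c := by exact_mod_cast hk.2.le
    rw [ENNReal.toReal_mul, idleRate, ENNReal.toReal_ofReal
      (mul_nonneg (by linarith) hm.b_zero_pos.le)]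
    ring
  · intro k hk
    rw [Finset.mem_Ico] at hk
    exact ENNReal.mul_ne_top ENNReal.ofReal_ne_top (hm.r_ne_top (by omega))

lemma IsModel.restartBusy_zero_ne_top (hm : IsModel c b h) (hneg : BiDerivOne b c < 0)
    (hmu : mu1 h < ∞) : restartBusy c b h 0 ≠ ∞ := by
  obtain ⟨h1, h2⟩ := hm.drift_eq hneg
  intro h0
  have h3 := hm.mul_restartBusy_eq (by simpa using h1) h2
  rw [h0, ENNReal.mul_top (by simpa using h1)] at h3
  exact ENNReal.add_ne_top.2 ⟨hmu.ne, hm.sum_idleRate_mul_r_ne_top⟩ h3.symm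

lemma IsModel.mul_toReal_restartBusy (hm : IsModel c b h) (hneg : BiDerivOne b c < 0)
    (hmu : mu1 h < ∞) : -(BiDerivOne b c).toReal * (restartBusy c b h 0).toReal =
      (mu1 h).toReal + rSum c b h := by
  obtain ⟨h1, h2⟩ := hm.drift_eq hneg
  have h3 := congrArg ENNReal.toReal (hm.mul_restartBusy_eq (by simpa using h1) h2)
  rwa [ENNReal.toReal_add hmu.ne hm.sum_idleRate_mul_r_ne_top, ENNReal.toReal_mul,
    ENNReal.toReal_ofReal h1.le, hm.toReal_sum_idleRate] at h3

/-- The probability of being killed is β times a mean busy time that stays bounded by its finite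
unkilled value, so it vanishes with β. -/
lemma IsModel.emptyProb_eq_one (hm : IsModel c b h) (hneg : BiDerivOne b c < 0) (i : ℕ) :
    emptyProb c b 0 i = 1 := by
  obtain ⟨h1, h2⟩ := hm.drift_eq hneg
  have hfin := hm.busyTime_ne_top (by simpa using h1) h2 i
  have h3 : Tendsto (fun β => emptyProb c b β i + ENNReal.ofReal β * busyTime c b β i) (𝓝[>] 0)
      (𝓝 (emptyProb c b 0 i + ENNReal.ofReal 0 * busyTime c b 0 i)) := by
    refine (hm.tendsto_minSol_killedRate _ i).add (ENNReal.Tendsto.mul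
      ((ENNReal.continuous_ofReal.tendsto 0).mono_left nhdsWithin_le_nhds) (Or.inr hfin)
      (hm.tendsto_minSol_killedRate _ i) (Or.inr ENNReal.ofReal_ne_top))
  rw [ENNReal.ofReal_zero, zero_mul, add_zero] at h3
  refine tendsto_nhds_unique h3 (tendsto_const_nhds.congr' ?_)
  filter_upwards [self_mem_nhdsWithin] with β hβ
  exact (hm.emptyProb_add_busyTime hβ i).symm

lemma IsModel.tendsto_mul_catastropheTime (hm : IsModel c b h) (hneg : BiDerivOne b c < 0)
    (hmu : mu1 h < ∞) {E : ℝ → ℕ → ℝ≥0∞}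
    (hE : ∀ β, 0 < β → IsCatastropheTime c b h β (E β)) (j : ℕ) :
    Tendsto (fun β => β * (E β j).toReal) (𝓝[>] 0)
      (𝓝 (1 + 1 / (restartBusy c b h 0).toReal)) := by
  have hT := hm.restartBusy_zero_ne_top hneg hmu
  have h1 : Tendsto (fun β => (restartBusy c b h β).toReal) (𝓝[>] 0)
      (𝓝 (restartBusy c b h 0).toReal) :=
    (ENNReal.tendsto_toReal hT).comp
      (hm.tendsto_tsum_minSol_killedRate _ fun _ => ENNReal.ofReal_ne_top)
  have h2 := ((hm.tendsto_emptyProb j).div h1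
    (ENNReal.toReal_pos (hm.restartBusy_ne_zero 0) hT).ne').const_add 1
  rw [hm.emptyProb_eq_one hneg, ENNReal.toReal_one] at h2
  refine h2.congr' ?_
  filter_upwards [self_mem_nhdsWithin] with β hβ
  exact ((hE β hβ).mul_toReal hm hβ j).symm

end Recurrent

/-! ### Equilibrium distributions -/

section Equilibrium

variable {c : ℕ} {b h : ℕ → ℝ}

/-- The balance equation in terms of the off-diagonal rates. -/
lemma hasSum_balance_iff {Q : ℕ → ℕ → ℝ} {π : ℕ → ℝ} (hπ : ∀ i, 0 ≤ π i) {j : ℕ}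
    (hQ : ∀ i, i ≠ j → 0 ≤ Q i j) (hQj : Q j j ≤ 0) :
    HasSum (fun i => π i * Q i j) 0 ↔
      ∑' i, offDiag Q i j * ENNReal.ofReal (π i) =
        ENNReal.ofReal (-Q j j) * ENNReal.ofReal (π j) := by
  set g : ℕ → ℝ := fun i => if i = j then 0 else π i * Q i j with hg
  have hg0 : ∀ i, 0 ≤ g i := by
    intro i
    simp only [hg]
    split_ifs with hi
    · exact le_rfl
    · exact mul_nonneg (hπ i) (hQ i hi)
  have h1 : ∀ i, offDiag Q i j * ENNReal.ofReal (π i) = ENNReal.ofReal (g i) := by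
    intro i
    by_cases hi : i = j
    · simp [offDiag, hg, hi]
    · simp only [offDiag, hg, hi, if_false, Ne.symm hi]
      rw [mul_comm, ENNReal.ofReal_mul (hπ i)]
  have hv : 0 ≤ -Q j j * π j := mul_nonneg (by linarith) (hπ j)
  have h2 : HasSum (fun i => π i * Q i j) 0 ↔ HasSum g (-Q j j * π j) := by
    have hs : HasSum (fun i => if i = j then π j * Q j j else 0) (π j * Q j j) :=
      hasSum_ite_eq j _
    have hge : (fun i => π i * Q i j) = fun i => g i + if i = j then π j * Q j j else 0 := by
      ext i
      by_cases hi : i = j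
      · simp [hg, hi]
      · simp [hg, hi]
    constructor
    · intro h3
      rw [hge] at h3
      simpa [neg_mul, mul_comm (Q j j)] using h3.sub hs
    · intro h3
      rw [hge]
      simpa [neg_mul, mul_comm (Q j j)] using h3.add hs
  simp only [h1]
  rw [h2, ← ENNReal.ofReal_mul (by linarith)]
  constructor
  · intro h3
    rw [← h3.tsum_eq, ENNReal.ofReal_tsum_of_nonneg hg0 h3.summable]
  · intro h3
    have hne : ∑' i, ENNReal.ofReal (g i) ≠ ∞ := by rw [h3]; exact ENNReal.ofReal_ne_top
    have h4 := ENNReal.hasSum_toReal hne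
    rw [← ENNReal.tsum_toReal_eq fun _ => ENNReal.ofReal_ne_top, h3,
      ENNReal.toReal_ofReal hv] at h4
    simpa only [ENNReal.toReal_ofReal (hg0 _)] using h4

/-- Total exit rates of the queue with restarts. -/
noncomputable def restartRate (c : ℕ) (b h : ℕ → ℝ) (j : ℕ) : ℝ≥0∞ :=
  if j = 0 then restartTotal h else killedRate c b 0 j

lemma IsModel.ofReal_neg_Qtilde (hm : IsModel c b h) (j : ℕ) :
    ENNReal.ofReal (-Qtilde c b h j j) = restartRate c b h j := by
  rw [restartRate]
  split_ifs with hj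
  · subst hj
    simp [Qtilde, Qs, Qstar, restartTotal]
  · rw [killedRate_zero_left, ← hm.exitRate_Qstar, exitRate, if_neg hj]
    simp [Qtilde, Qs, hj]

lemma IsModel.Qtilde_self_nonpos (hm : IsModel c b h) (j : ℕ) : Qtilde c b h j j ≤ 0 := by
  by_cases hj : j = 0
  · subst hj
    simpa [Qtilde, Qs, Qstar] using hm.h_pos.le
  · simpa [Qtilde, Qs, hj] using (hm.Qstar_self_neg hj).le

lemma IsModel.Qtilde_nonneg (hm : IsModel c b h) {i j : ℕ} (hij : i ≠ j) :
    0 ≤ Qtilde c b h i j := by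
  refine add_nonneg ?_ ?_
  · unfold Qstar
    split_ifs with h1 h2 h3 h4
    · exact le_rfl
    · exact mul_nonneg (Nat.cast_nonneg _) hm.b_zero_pos.le
    · exact absurd h3.symm hij
    · exact hm.b_nonneg _ (by omega)
    · exact le_rfl
  · unfold Qs
    split_ifs with h1 h2
    · exact absurd (h1.trans h2.symm) hij
    · exact hm.h_nonneg j
    · exact le_rfl

lemma IsModel.offDiag_Qtilde_zero (hm : IsModel c b h) (j : ℕ) :
    offDiag (Qtilde c b h) 0 j = ENNReal.ofReal (h j) := by
  by_cases hj : j = 0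
  · simp [offDiag, hj, hm.h_zero]
  · simp [offDiag, hj, Qtilde, Qstar, Qs]

lemma offDiag_Qtilde_succ (i j : ℕ) :
    offDiag (Qtilde c b h) (i + 1) j = jump c b (i + 1) j := by
  simp [offDiag, jump, Qtilde, Qs]

lemma IsModel.tsum_offDiag_Qtilde (hm : IsModel c b h) (x : ℕ → ℝ≥0∞) (j : ℕ) :
    ∑' i, offDiag (Qtilde c b h) i j * x i =
      ENNReal.ofReal (h j) * x 0 + ∑' i, jump c b i j * x i := by
  rw [tsum_eq_zero_add' ENNReal.summable,
    tsum_eq_zero_add' (f := fun i => jump c b i j * x i) ENNReal.summable, jump_zero, zero_mul,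
    zero_add, hm.offDiag_Qtilde_zero]
  simp only [offDiag_Qtilde_succ]

lemma IsModel.isEquilibrium_iff (hm : IsModel c b h) {π : ℕ → ℝ} (hπ : ∀ i, 0 ≤ π i) :
    IsEquilibrium (Qtilde c b h) π ↔ HasSum π 1 ∧ ∀ j,
      ENNReal.ofReal (h j) * ENNReal.ofReal (π 0) + ∑' i, jump c b i j * ENNReal.ofReal (π i) =
        restartRate c b h j * ENNReal.ofReal (π j) := by
  have h1 : ∀ j, HasSum (fun i => π i * Qtilde c b h i j) 0 ↔
      ENNReal.ofReal (h j) * ENNReal.ofReal (π 0) + ∑' i, jump c b i j * ENNReal.ofReal (π i) =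
        restartRate c b h j * ENNReal.ofReal (π j) := by
    intro j
    rw [hasSum_balance_iff hπ (fun i hi => hm.Qtilde_nonneg hi) (hm.Qtilde_self_nonpos j),
      hm.ofReal_neg_Qtilde, hm.tsum_offDiag_Qtilde fun i => ENNReal.ofReal (π i)]
  exact ⟨fun h2 => ⟨h2.hasSum_one, fun j => (h1 j).1 (h2.balance j)⟩,
    fun h2 => ⟨hπ, h2.1, fun j => (h1 j).2 (h2.2 j)⟩⟩

lemma IsModel.restartRate_le (hm : IsModel c b h) (j : ℕ) :
    restartRate c b h j ≤ restartTotal h + (ENNReal.ofReal (c * b 0) + upTotal b) := by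
  rw [restartRate]
  split_ifs with hj
  · exact le_self_add
  · obtain ⟨j, rfl⟩ := Nat.exists_eq_succ_of_ne_zero hj
    rw [Nat.succ_eq_add_one, killedRate_succ, ENNReal.ofReal_zero, add_zero]
    refine le_trans ?_ le_add_self
    gcongr
    exact hm.downRate_le _

/-- Testing an equilibrium distribution against the probabilities of emptying. -/
lemma IsModel.equilibrium_identity (hm : IsModel c b h) {π : ℕ → ℝ}
    (hπ : IsEquilibrium (Qtilde c b h) π) {β : ℝ} (hβ : 0 < β) :
    ENNReal.ofReal (π 0) * restartBusy c b h β =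
      ∑' i, ENNReal.ofReal (π i) * busy i * emptyProb c b β i := by
  set p : ℕ → ℝ≥0∞ := fun i => ENNReal.ofReal (π i) with hp
  have hβ0 : ENNReal.ofReal β ≠ 0 := by simpa using hβ
  have hsum : ∑' i, p i = 1 := by
    rw [hp, ← ENNReal.ofReal_tsum_of_nonneg hπ.nonneg hπ.hasSum_one.summable,
      hπ.hasSum_one.tsum_eq, ENNReal.ofReal_one]
  have hbal := ((hm.isEquilibrium_iff hπ.nonneg).1 hπ).2
  set f := emptyProb c b β with hf
  -- The unkilled flow out of the busy states. It occurs on both sides and cancels because bounded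
  -- rates make it finite.
  set X := ∑' i, p (i + 1) * (killedRate c b 0 (i + 1) * f (i + 1)) with hX
  have hXt : X ≠ ∞ := by
    have h1 : X ≤ restartTotal h + (ENNReal.ofReal (c * b 0) + upTotal b) := by
      calc X ≤ ∑' i, p (i + 1) *
            (restartTotal h + (ENNReal.ofReal (c * b 0) + upTotal b)) := by
            rw [hX]
            gcongr with i
            have h2 := hm.restartRate_le (i + 1)
            rw [restartRate, if_neg (Nat.succ_ne_zero i)] at h2
            exact (mul_le_of_le_one_right' (hm.emptyProb_le_one β _)).trans h2
        _ ≤ 1 * (restartTotal h + (ENNReal.ofReal (c * b 0) + upTotal b)) := by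
            have h2 : ∑' i, p (i + 1) ≤ 1 := by
              rw [← hsum, tsum_eq_zero_add' (f := p) ENNReal.summable]
              exact le_add_self
            rw [ENNReal.tsum_mul_right]
            gcongr
        _ = _ := one_mul _
    refine ne_top_of_le_ne_top ?_ h1
    exact ENNReal.add_ne_top.2 ⟨ENNReal.ofReal_ne_top,
      ENNReal.add_ne_top.2 ⟨ENNReal.ofReal_ne_top, hm.upTotal_ne_top⟩⟩
  have h1 : ∑' j, restartRate c b h j * p j * f j = p 0 * restartTotal h + X := by
    rw [tsum_eq_zero_add' ENNReal.summable, hX]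
    congr 1
    · rw [restartRate, if_pos rfl, hf, hm.emptyProb_zero, mul_one, mul_comm]
    · congr 1; ext i
      rw [restartRate, if_neg (Nat.succ_ne_zero i)]
      ring
  have h2 : ∑' j, restartRate c b h j * p j * f j = p 0 * restartEmpty c b h β +
      (X + ENNReal.ofReal β * ∑' i, p i * busy i * f i) := by
    have h3 : ∀ j, restartRate c b h j * p j * f j = p 0 * (ENNReal.ofReal (h j) * f j) +
        ∑' i, jump c b i j * p i * f j := by
      intro j
      rw [← hbal j, add_mul, ENNReal.tsum_mul_right]
      congr 1
      ring
    simp only [h3]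
    rw [ENNReal.tsum_add, ENNReal.tsum_mul_left, restartEmpty, ENNReal.tsum_comm]
    congr 1
    rw [tsum_eq_zero_add' ENNReal.summable,
      tsum_eq_zero_add' (f := fun i => p i * busy i * f i) ENNReal.summable]
    simp only [jump_zero, zero_mul, tsum_zero, zero_add, busy_zero, mul_zero, busy_succ, mul_one]
    rw [hX, ← ENNReal.tsum_mul_left, ← ENNReal.tsum_add]
    congr 1; ext i
    have h4 : ∑' j, jump c b (i + 1) j * p (i + 1) * f j =
        p (i + 1) * ∑' j, jump c b (i + 1) j * f j := by
      rw [← ENNReal.tsum_mul_left]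
      congr 1; ext j; ring
    rw [h4, hf, ← hm.killedRate_mul_emptyProb, killedRate_succ, killedRate_succ,
      ENNReal.ofReal_zero]
    ring
  rw [h1, ← hm.restartEmpty_add hβ] at h2
  have h5 : p 0 * restartEmpty c b h β + X ≠ ∞ := ENNReal.add_ne_top.2
    ⟨ENNReal.mul_ne_top ENNReal.ofReal_ne_top (hm.restartEmpty_ne_top β), hXt⟩
  have h6 : (p 0 * restartEmpty c b h β + X) + ENNReal.ofReal β * (p 0 * restartBusy c b h β) =
      (p 0 * restartEmpty c b h β + X) +
        ENNReal.ofReal β * ∑' i, p i * busy i * f i := by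
    rw [add_assoc (p 0 * restartEmpty c b h β) X (ENNReal.ofReal β * ∑' i, p i * busy i * f i),
      ← h2]
    ring
  exact (ENNReal.mul_right_inj hβ0 ENNReal.ofReal_ne_top).1 ((ENNReal.add_right_inj h5).1 h6)

/-- Let β ↓ 0 in `IsModel.equilibrium_identity`; all emptying probabilities become 1, leaving the
equilibrium mass off 0. -/
lemma IsModel.equilibrium_zero (hm : IsModel c b h) (hneg : BiDerivOne b c < 0)
    (hmu : mu1 h < ∞) {π : ℕ → ℝ} (hπ : IsEquilibrium (Qtilde c b h) π) :
    π 0 * (restartBusy c b h 0).toReal = 1 - π 0 := by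
  have hT := hm.restartBusy_zero_ne_top hneg hmu
  have h1 : Tendsto (fun β => ENNReal.ofReal (π 0) * restartBusy c b h β) (𝓝[>] 0)
      (𝓝 (ENNReal.ofReal (π 0) * restartBusy c b h 0)) :=
    ENNReal.Tendsto.const_mul
      (hm.tendsto_tsum_minSol_killedRate _ fun _ => ENNReal.ofReal_ne_top)
      (Or.inr ENNReal.ofReal_ne_top)
  have h2 : Tendsto (fun β => ∑' i, ENNReal.ofReal (π i) * busy i * emptyProb c b β i) (𝓝[>] 0)
      (𝓝 (∑' i, ENNReal.ofReal (π i) * busy i * emptyProb c b 0 i)) :=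
    hm.tendsto_tsum_minSol_killedRate _
      fun i => ENNReal.mul_ne_top ENNReal.ofReal_ne_top (busy_ne_top i)
  have h3 : ENNReal.ofReal (π 0) * restartBusy c b h 0 =
      ∑' i, ENNReal.ofReal (π i) * busy i * emptyProb c b 0 i := by
    refine tendsto_nhds_unique h1 (h2.congr' ?_)
    filter_upwards [self_mem_nhdsWithin] with β hβ
    exact (hm.equilibrium_identity hπ hβ).symm
  have hsum : ∑' i, ENNReal.ofReal (π i) = 1 := by
    rw [← ENNReal.ofReal_tsum_of_nonneg hπ.nonneg hπ.hasSum_one.summable,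
      hπ.hasSum_one.tsum_eq, ENNReal.ofReal_one]
  have h4 : ENNReal.ofReal (π 0) + ENNReal.ofReal (π 0) * restartBusy c b h 0 = 1 := by
    rw [h3, ← hsum, tsum_eq_zero_add' (f := fun i => ENNReal.ofReal (π i)) ENNReal.summable,
      tsum_eq_zero_add' ENNReal.summable]
    simp [hm.emptyProb_eq_one hneg]
  have h5 := congrArg ENNReal.toReal h4
  rw [ENNReal.toReal_add ENNReal.ofReal_ne_top (ENNReal.mul_ne_top ENNReal.ofReal_ne_top hT),
    ENNReal.toReal_mul, ENNReal.toReal_ofReal (hπ.nonneg 0), ENNReal.toReal_one] at h5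
  linarith

/-- The invariant measure with weight `1` at `0`. -/
noncomputable def invariantMeasure (c : ℕ) (b h : ℕ → ℝ) (j : ℕ) : ℝ≥0∞ :=
  if j = 0 then 1 else r c b h j

/-- Summing the Green function over all target states `j ≥ 1` gives the mean busy time. -/
lemma IsModel.tsum_invariantMeasure (hm : IsModel c b h) :
    ∑' j, invariantMeasure c b h j = 1 + restartBusy c b h 0 := by
  rw [tsum_eq_zero_add' ENNReal.summable, invariantMeasure, if_pos rfl, restartBusy]
  congr 1
  have h1 : ∀ l, busyTime c b 0 l = ∑' j, green c b (j + 1) l := by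
    intro l
    rw [busyTime, minSol_eq_tsum_single, tsum_eq_zero_add' ENNReal.summable]
    simp [green]
  simp only [h1, ← ENNReal.tsum_mul_left]
  rw [ENNReal.tsum_comm]
  congr 1; ext j
  rw [invariantMeasure, if_neg (Nat.succ_ne_zero j), hm.r_eq (Nat.succ_ne_zero j)]

/-- Average the forward equations of the Green function against `h`. Recurrence is needed only at 0,
where the returning flow must equal the full restart rate. -/
lemma IsModel.invariantMeasure_balance (hm : IsModel c b h) (hneg : BiDerivOne b c < 0) (j : ℕ) :
    ENNReal.ofReal (h j) * invariantMeasure c b h 0 +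
      ∑' i, jump c b i j * invariantMeasure c b h i =
        restartRate c b h j * invariantMeasure c b h j := by
  have h0 : ∑' i, jump c b i j * invariantMeasure c b h i =
      ∑' l, ENNReal.ofReal (h l) * ∑' i, jump c b i j * green c b i l := by
    simp only [← ENNReal.tsum_mul_left]
    rw [ENNReal.tsum_comm]
    congr 1; ext i
    cases i with
    | zero => simp
    | succ i =>
      rw [invariantMeasure, if_neg (Nat.succ_ne_zero i), hm.r_eq (Nat.succ_ne_zero i),
        ← ENNReal.tsum_mul_left]
      congr 1; ext l; ring
  have h1 : ENNReal.ofReal (h j) =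
      ∑' l, ENNReal.ofReal (h l) * (Pi.single j 1 : ℕ → ℝ≥0∞) l := by
    rw [tsum_eq_single j]
    · simp
    · intro l hl; simp [hl]
  have h2 : ENNReal.ofReal (h j) + ∑' i, jump c b i j * invariantMeasure c b h i =
      ∑' l, ENNReal.ofReal (h l) * (killedRate c b 0 j * green c b j l) := by
    rw [h0]
    conv_lhs => rw [h1]
    rw [← ENNReal.tsum_add]
    congr 1; ext l
    rw [hm.green_forward, mul_add]
  rw [show invariantMeasure c b h 0 = 1 from if_pos rfl, mul_one, h2]
  cases j with
  | zero =>
    rw [restartRate, if_pos rfl, show invariantMeasure c b h 0 = 1 from if_pos rfl, mul_one,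
      ← hm.tsum_restart]
    congr 1; ext l
    rw [killedRate_zero, one_mul, ← emptyProb_zero_rate, hm.emptyProb_eq_one hneg, mul_one]
  | succ j =>
    rw [restartRate, if_neg (Nat.succ_ne_zero j), invariantMeasure, if_neg (Nat.succ_ne_zero j),
      hm.r_eq (Nat.succ_ne_zero j), ← ENNReal.tsum_mul_left]
    congr 1; ext l; ring

lemma IsModel.exists_isEquilibrium (hm : IsModel c b h) (hneg : BiDerivOne b c < 0)
    (hmu : mu1 h < ∞) : ∃ π : ℕ → ℝ, IsEquilibrium (Qtilde c b h) π := by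
  have hT := hm.restartBusy_zero_ne_top hneg hmu
  set Z := 1 + restartBusy c b h 0 with hZ
  have hZt : Z ≠ ∞ := ENNReal.add_ne_top.2 ⟨ENNReal.one_ne_top, hT⟩
  have hZ0 : Z ≠ 0 := fun h0 => one_ne_zero (add_eq_zero.1 h0).1
  set ν : ℕ → ℝ≥0∞ := fun j => Z⁻¹ * invariantMeasure c b h j with hν
  have hsum : ∑' j, ν j = 1 := by
    rw [hν, ENNReal.tsum_mul_left, hm.tsum_invariantMeasure, ENNReal.inv_mul_cancel hZ0 hZt]
  have hfin : ∀ j, ν j ≠ ∞ := fun j =>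
    ENNReal.ne_top_of_tsum_ne_top (by rw [hsum]; exact ENNReal.one_ne_top) j
  refine ⟨fun j => (ν j).toReal, (hm.isEquilibrium_iff fun _ => ENNReal.toReal_nonneg).2 ⟨?_, ?_⟩⟩
  · have h1 := ENNReal.hasSum_toReal (f := ν) (by rw [hsum]; exact ENNReal.one_ne_top)
    rwa [← ENNReal.tsum_toReal_eq hfin, hsum, ENNReal.toReal_one] at h1
  · intro j
    simp only [ENNReal.ofReal_toReal (hfin _)]
    have h1 := congrArg (fun x => Z⁻¹ * x) (hm.invariantMeasure_balance hneg j)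
    simp only [mul_add, ← ENNReal.tsum_mul_left] at h1
    simp only [hν]
    convert h1 using 1
    · congr 1
      · ring
      · congr 1; ext i; ring
    · ring

end Equilibrium

end MXMc

/-! ### Assembly of the three regimes. -/

theorem theorem4p7 {c : ℕ} {b h : ℕ → ℝ} (hmodel : MXMc.IsModel c b h)
    {Ω : ℝ → ℕ → Type*} [∀ β j, MeasurableSpace (Ω β j)]
    (P : ∀ β j, Measure (Ω β j)) (M : ∀ β j, ℝ≥0 → Ω β j → Option ℕ)
    (hM : ∀ β : ℝ, 0 < β → ∀ j : ℕ,
      MXMc.IsQProcess (MXMc.QM c b h β) (some j) (P β j) (M β j))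
    (C : ∀ β j, Ω β j → ℝ≥0∞)
    (hC : ∀ β j ω, C β j ω = MXMc.hittingTime (M β j) none ω)
    (EC : ℝ → ℕ → ℝ≥0∞) (hEC : ∀ β j, EC β j = ∫⁻ ω, C β j ω ∂(P β j)) :
    -- the quantities in the limits below are finite
    (∀ β : ℝ, 0 < β → ∀ j : ℕ, EC β j ≠ ∞) ∧
    (∀ k i : ℕ, 1 ≤ k → 1 ≤ i → MXMc.mstar c b k i ≠ ∞) ∧
    (∀ k : ℕ, 1 ≤ k → MXMc.r c b h k ≠ ∞) ∧
    -- `β ↓ 0`, positive recurrent case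
    (MXMc.BiDerivOne b c < 0 → MXMc.mu1 h < ∞ →
      (∀ j : ℕ, Tendsto (fun β : ℝ => β * (EC β j).toReal) (𝓝[>] 0)
        (𝓝 ((-(MXMc.BiDerivOne b c).toReal + (MXMc.mu1 h).toReal + MXMc.rSum c b h) /
          ((MXMc.mu1 h).toReal + MXMc.rSum c b h)))) ∧
      (∃ π : ℕ → ℝ, MXMc.IsEquilibrium (MXMc.Qtilde c b h) π) ∧
      (∀ π : ℕ → ℝ, MXMc.IsEquilibrium (MXMc.Qtilde c b h) π → π 0 < 1 ∧
        ∀ j : ℕ, Tendsto (fun β : ℝ => β * (EC β j).toReal) (𝓝[>] 0) (𝓝 (1 / (1 - π 0))))) ∧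
    -- `β ↓ 0`, transient case
    (0 < MXMc.BiDerivOne b c →
      Tendsto (fun β : ℝ => (EC β 0).toReal - 1 / β) (𝓝[>] 0)
        (𝓝 (1 / MXMc.transientDenom c b h)) ∧
      ∀ j : ℕ, 1 ≤ j → Tendsto (fun β : ℝ => (EC β j).toReal - 1 / β) (𝓝[>] 0)
        (𝓝 (b 0 * (MXMc.mstar c b 1 j).toReal / MXMc.transientDenom c b h))) ∧
    -- `β → ∞`
    Tendsto (fun β : ℝ => (EC β 0).toReal) atTop (𝓝 (1 / ∑' k, h k)) ∧
    Tendsto (fun β : ℝ => β * (EC β 1).toReal) atTop (𝓝 (1 + b 0 / ∑' k, h k)) ∧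
    (∀ j : ℕ, 2 ≤ j → Tendsto (fun β : ℝ => β * (EC β j).toReal) atTop (𝓝 1)) := by
  have hE : ∀ β : ℝ, 0 < β → MXMc.IsCatastropheTime c b h β (EC β) := by
    intro β hβ
    have h1 := hmodel.isCatastropheTime hβ (hM β hβ)
    convert h1 using 1
    ext j
    rw [hEC]
    exact lintegral_congr fun ω => hC β j ω
  refine ⟨fun β hβ j => (hE β hβ).ne_top hmodel hβ j, fun k i _ hi => ?_,
    fun k hk => hmodel.r_ne_top (by omega), fun hneg hmu => ?_, fun hpos => ?_,
    MXMc.tendsto_catastropheTime_zero_atTop hmodel hE,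
    MXMc.tendsto_catastropheTime_one_atTop hmodel hE, fun j hj => ?_⟩
  · rw [hmodel.mstar_eq (by omega)]
    exact hmodel.green_ne_top (by omega) i
  · have hα := (hmodel.drift_eq hneg).1
    have hA : 0 < (MXMc.restartBusy c b h 0).toReal := ENNReal.toReal_pos
      (hmodel.restartBusy_ne_zero 0) (hmodel.restartBusy_zero_ne_top hneg hmu)
    have hlim := fun j => hmodel.tendsto_mul_catastropheTime hneg hmu hE j
    refine ⟨fun j => ?_, hmodel.exists_isEquilibrium hneg hmu, fun π hπ => ?_⟩
    -- The limit is 1 + 1/T(0), and -B_c'(1) T(0) = μ₁ + `rSum`.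
    · convert hlim j using 2
      rw [add_assoc, ← hmodel.mul_toReal_restartBusy hneg hmu]
      generalize -(MXMc.BiDerivOne b c).toReal = α at hα
      field_simp
      ring
    · have h1 := hmodel.equilibrium_zero hneg hmu hπ
      set A := (MXMc.restartBusy c b h 0).toReal
      -- Since π_0 T(0) = 1 - π_0 with T(0) > 0, a value π_0 ≥ 1 would give the two sides opposite
      -- signs.
      have h2 : π 0 < 1 := by
        by_contra hcon
        nlinarith [hπ.nonneg 0]
      refine ⟨h2, fun j => ?_⟩
      convert hlim j using 2
      have h3 : 1 - π 0 ≠ 0 := by linarith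
      field_simp
      linarith
  · refine ⟨?_, fun j hj => ?_⟩
    · have h1 := hmodel.tendsto_catastropheTime_transient hpos hE 0
      rwa [hmodel.emptyProb_zero, ENNReal.toReal_one] at h1
    · have h1 := hmodel.tendsto_catastropheTime_transient hpos hE j
      rwa [hmodel.emptyProb_eq (by omega), ENNReal.toReal_mul,
        ENNReal.toReal_ofReal hmodel.b_zero_pos.le, MXMc.green,
        ← hmodel.mstar_eq one_ne_zero] at h1
  · obtain ⟨j, rfl⟩ := Nat.exists_eq_add_of_le' hj
    exact MXMc.tendsto_catastropheTime_succ_atTop hmodel hE j
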